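/- All algebras are over $\mathbb{C}$ and are not assumed associative or unital. An *evolution algebra* is an algebra having a *natural basis*, i.e. a linear basis in which any two distinct elements have product $0$. It is *complete* if every subalgebra has a natural basis that extends to a natural basis of the whole algebra. Put $A^1=A$, $A^k=\sum_{i=1}^{k-1}A^iA^{k-i}$ for $k\ge 2$; $A$ is *nilpotent* if $A^k=0$ for some $k\ge 1$, and the least such $k$ is its *index of nilpotency*. An $s$-dimensional nilpotent evolution algebra has *maximal index of nilpotency* if its index is the largest one among all $s$-dimensional nilpotent evolution algebras. Let $\{e_1^2=e_1\}$ be the one-dimensional evolution algebra spanned by a nonzero idempotent, and $\mathbb{C}^k$ the $k$-dimensional algebra with zero multiplication ($k\ge 0$). **Corollary.** Let $n\ge 1$ and let $\mathcal{E}$ be an $n$-dimensional complete evolution algebra. Then $\mathcal{E}$ is isomorphic to an algebra of one of the following types: 1. $\{e_1^2=e_1\}$ (with $n=1$); 2. $\widetilde{\mathcal{E}}\oplus\mathbb{C}^{n-s}$ with $1\le s\le n$; 3. $\{e_1^2=e_1\}\oplus\mathbb{C}^{n-1}$ (with $n\ge 2$); 4. $\{e_1^2=e_1\}\oplus\widetilde{\mathcal{E}}\oplus\mathbb{C}^{n-s-1}$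 with $2\le s\le n-1$; where $\widetilde{\mathcal{E}}$ is an $s$-dimensional evolution algebra with maximal index of nilpotency. These algebras are pairwise non-isomorphic: algebras of two different types are never isomorphic, and if two algebras of type 2 (respectively of type 4), given by $(s,\widetilde{\mathcal{E}})$ and $(s',\widetilde{\mathcal{E}}')$, are isomorphic, then $s=s'$ and $\widetilde{\mathcal{E}}\cong\widetilde{\mathcal{E}}'$. -/

import Mathlib

open Module

/-! Algebras over `ℂ` are not assumed associative or unital: an algebra is a type `A` with
`[NonUnitalNonAssocRing A] [Module ℂ A] [IsScalarTower ℂ A A] [SMulCommClass ℂ A A]`. -/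

section General

universe u v

/-- A natural basis of an algebra: a linear basis (as a set of vectors) such that the product of
any two distinct elements is zero. -/
def IsNaturalBasis (A : Type u) [NonUnitalNonAssocRing A] [Module ℂ A] (B : Set A) : Prop :=
  LinearIndepOn ℂ id B ∧ Submodule.span ℂ B = ⊤ ∧ B.Pairwise fun x y => x * y = 0

/-- An evolution algebra is an algebra which admits a natural basis. -/
def IsEvolutionAlgebra (A : Type u) [NonUnitalNonAssocRing A] [Module ℂ A] : Prop :=
  ∃ B : Set A, IsNaturalBasis A B

/-- A complete evolution algebra: every subalgebra admits a natural basis which extends to a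
natural basis of the whole algebra. -/
def IsCompleteEvolutionAlgebra (A : Type u) [NonUnitalNonAssocRing A] [Module ℂ A] : Prop :=
  IsEvolutionAlgebra A ∧
    ∀ S : NonUnitalSubalgebra ℂ A, ∃ B : Set S, IsNaturalBasis S B ∧
      ∃ B' : Set A, IsNaturalBasis A B' ∧ (fun x : S => (x : A)) '' B ⊆ B'

/-- Two algebras are isomorphic. -/
def IsIsomorphic (A : Type u) [NonUnitalNonAssocRing A] [Module ℂ A]
    (A' : Type v) [NonUnitalNonAssocRing A'] [Module ℂ A'] : Prop :=
  ∃ f : A →ₙₐ[ℂ] A', Function.Bijective f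

variable (A : Type u) [NonUnitalNonAssocRing A] [Module ℂ A]
  [IsScalarTower ℂ A A] [SMulCommClass ℂ A A]

/-- The powers of an algebra: `A ^ 1 = A` and `A ^ k = ∑_{i = 1}^{k - 1} A ^ i * A ^ (k - i)` for
`k ≥ 2`, where the product of two subspaces is the span of the products of their elements.
(The value at `0` is never used.) -/
noncomputable def algPower : ℕ → Submodule ℂ A
  | 0 => ⊤
  | 1 => ⊤
  | k + 2 => ⨆ i : Fin (k + 1),
      Submodule.map₂ (LinearMap.mul ℂ A) (algPower (i + 1)) (algPower (k + 1 - i))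
  decreasing_by all_goals omega

/-- An algebra is nilpotent if one of its powers is zero. -/
def IsNilpotentAlgebra : Prop := ∃ k : ℕ, 1 ≤ k ∧ algPower A k = ⊥

/-- The index of nilpotency of a nilpotent algebra: the least `k ≥ 1` with `A ^ k = 0`. -/
noncomputable def nilpotencyIndex : ℕ := sInf {k : ℕ | 1 ≤ k ∧ algPower A k = ⊥}

/-- `A` is a nilpotent evolution algebra of maximal index of nilpotency: its index is the largest
one among all nilpotent evolution algebras of the same (finite) dimension. -/
def HasMaximalNilpotencyIndex : Prop :=
  IsEvolutionAlgebra A ∧ IsNilpotentAlgebra A ∧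
    ∀ (F : Type u) [NonUnitalNonAssocRing F] [Module ℂ F] [IsScalarTower ℂ F F]
      [SMulCommClass ℂ F F] [FiniteDimensional ℂ F],
      IsEvolutionAlgebra F → IsNilpotentAlgebra F → finrank ℂ F = finrank ℂ A →
        nilpotencyIndex F ≤ nilpotencyIndex A

end General

/-- The evolution algebra with natural basis `(e i)` indexed by `ι` and structure matrix `M`,
that is `e i * e i = ∑ k, M i k • e k` and `e i * e j = 0` for `i ≠ j`; an element is given by its
vector of coordinates in this basis. -/
@[ext]
structure EvoAlg {ι : Type} (M : Matrix ι ι ℂ) : Type where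
  /-- The coordinates in the basis `(e i)`. -/
  coord : ι → ℂ

namespace EvoAlg

variable {ι : Type} (M : Matrix ι ι ℂ)

/-- The passage between elements and coordinate vectors. -/
def coordEquiv : EvoAlg M ≃ (ι → ℂ) where
  toFun := coord
  invFun := mk
  left_inv _ := rfl
  right_inv _ := rfl

instance instAddCommGroup : AddCommGroup (EvoAlg M) := (coordEquiv M).addCommGroup

instance instModule : Module ℂ (EvoAlg M) := (coordEquiv M).module ℂ

variable {M}

@[simp] theorem coord_zero : (0 : EvoAlg M).coord = 0 := rfl

@[simp] theorem coord_add (x y : EvoAlg M) : (x + y).coord = x.coord + y.coord := rfl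

@[simp] theorem coord_neg (x : EvoAlg M) : (-x).coord = -x.coord := rfl

@[simp] theorem coord_sub (x y : EvoAlg M) : (x - y).coord = x.coord - y.coord := rfl

@[simp] theorem coord_smul (c : ℂ) (x : EvoAlg M) : (c • x).coord = c • x.coord := rfl

variable (M)

/-- The coordinates as a linear equivalence. -/
def coordLinearEquiv : EvoAlg M ≃ₗ[ℂ] (ι → ℂ) :=
  { coordEquiv M with
    map_add' := coord_add
    map_smul' := coord_smul }

variable [Fintype ι]

instance instFiniteDimensional : FiniteDimensional ℂ (EvoAlg M) :=
  (coordLinearEquiv M).symm.finiteDimensional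

instance instMul : Mul (EvoAlg M) := ⟨fun x y => ⟨fun k => ∑ i, x.coord i * y.coord i * M i k⟩⟩

variable {M}

theorem coord_mul (x y : EvoAlg M) (k : ι) :
    (x * y).coord k = ∑ i, x.coord i * y.coord i * M i k := rfl

variable (M)

instance instNonUnitalNonAssocRing : NonUnitalNonAssocRing (EvoAlg M) where
  __ := instAddCommGroup M
  __ := instMul M
  left_distrib x y z := by
    ext k
    simp [coord_mul, mul_add, add_mul, Finset.sum_add_distrib]
  right_distrib x y z := by
    ext k
    simp [coord_mul, add_mul, Finset.sum_add_distrib]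
  zero_mul x := by
    ext k
    simp [coord_mul]
  mul_zero x := by
    ext k
    simp [coord_mul]

instance instIsScalarTower : IsScalarTower ℂ (EvoAlg M) (EvoAlg M) where
  smul_assoc c x y := by
    ext k
    simp [coord_mul, Finset.mul_sum, mul_assoc]

instance instSMulCommClass : SMulCommClass ℂ (EvoAlg M) (EvoAlg M) where
  smul_comm c x y := by
    ext k
    simp [coord_mul, Finset.mul_sum, mul_assoc, mul_left_comm]

end EvoAlg

/-- The one-dimensional evolution algebra `{e₁² = e₁}`. -/
abbrev IdemAlg : Type := EvoAlg (1 : Matrix (Fin 1) (Fin 1) ℂ)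

/-- The `k`-dimensional zero evolution algebra `ℂ^k`. -/
abbrev ZeroAlg (k : ℕ) : Type := EvoAlg (0 : Matrix (Fin k) (Fin k) ℂ)

/-! Beyond the existence of a natural basis, completeness enters only as the absorption property
`IsAbsorbing`: if S is a subalgebra and the squares of its elements lie in a subspace W, then S·E ⊆
W. Indeed S is spanned by members of a natural basis of E, and xy is a combination of the squares of
those occurring in x. Write Z_k for the ascending annihilator series. Absorption, applied to small
subalgebras modulo an ideal, separates the squares of basis vectors
(`IsNatural.smul_sq_mem_of_sum_mem`), and each layer Z_{k+1}/Z_k with k ≥ 1 gets at most one basis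
vector (`IsNatural.eq_of_mem_annSeries`).

Let Z be the stable term. If Z ≠ E, a quadratic system solved through the Nullstellensatz
(`exists_ne_zero_forall_sq_eq`) yields idempotents modulo Z. Two basis vectors outside Z would
produce an idempotent modulo Z with two nonzero coordinates there, which absorption forbids; so Z
has codimension one (`IsNatural.eq_of_notMem`), the idempotent lifts to E and annihilates Z, and E =
ℂe ⊕ Z. If the series takes at least two steps, Z is an algebra with one dimension per layer plus a
complement inside the annihilator (`IsNatural.exists_hom_annSeries`); otherwise Z has zero
multiplication.

A nilpotent evolution algebra of dimension s ≥ 1 has A^m ⊆ Z_{s - ⌈log₂ m⌉}, hence index at most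
2^(s-1) + 1. The chain e_i² = e_{i+1} attains this, so maximality means A^(2^(s-1)) ≠ 0. For s ≥ 2
the annihilator then lies in A², so an embedding into B ⊕ ℂ^k stays injective after projection to B
(`EvoAlg.injective_fst_comp`). This recovers s and the nilpotent summand; idempotents and dimensions
separate most types. -/

set_option linter.unusedSectionVars false

/-! ### Natural bases, absorption and the annihilator series. -/

section NaturalBases

variable {E : Type*} [NonUnitalNonAssocRing E] [Module ℂ E]

/-- A natural basis given as an indexed family. -/
def IsNatural {ι : Type*} (v : Basis ι ℂ E) : Prop := Pairwise fun i j => v i * v j = 0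

theorem IsNaturalBasis.exists_basis [FiniteDimensional ℂ E] {B : Set E} (hB : IsNaturalBasis E B) :
    ∃ v : Basis (Fin (finrank ℂ E)) ℂ E, IsNatural v ∧ Set.range v = B := by
  obtain ⟨hli, hsp, hmul⟩ := hB
  have hli' : LinearIndependent ℂ (fun x : B => (x : E)) := hli
  let v₀ : Basis B ℂ E := Basis.mk hli' (by simpa using hsp.ge)
  have hv₀ : ∀ b, v₀ b = (b : E) := fun b => Basis.mk_apply _ _ b
  have : Fintype B := FiniteDimensional.fintypeBasisIndex v₀
  let eq := Fintype.equivFinOfCardEq (finrank_eq_card_basis v₀).symm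
  refine ⟨v₀.reindex eq, ?_, ?_⟩
  · intro i j hij
    simp only [Basis.reindex_apply, hv₀]
    exact hmul (eq.symm i).2 (eq.symm j).2
      (fun h => hij (eq.symm.injective (Subtype.ext h)))
  · ext x
    simp only [Basis.coe_reindex, EquivLike.range_comp, Set.mem_range, hv₀]
    simp

theorem IsNatural.isEvolutionAlgebra {ι : Type*} {v : Basis ι ℂ E} (hv : IsNatural v) :
    IsEvolutionAlgebra E := by
  refine ⟨Set.range v, v.linearIndependent.linearIndepOn_id, v.span_eq, ?_⟩
  rintro _ ⟨i, rfl⟩ _ ⟨j, rfl⟩ hij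
  exact hv (fun h => hij (by rw [h]))

theorem IsEvolutionAlgebra.exists_basis [FiniteDimensional ℂ E] (hE : IsEvolutionAlgebra E) :
    ∃ v : Basis (Fin (finrank ℂ E)) ℂ E, IsNatural v := by
  obtain ⟨B, hB⟩ := hE
  obtain ⟨v, hv, -⟩ := hB.exists_basis
  exact ⟨v, hv⟩

/-- Completeness in coordinates: the natural basis of `S` is part of `v`, so an element of `S`
involves only those `v i` that lie in `S`. -/
theorem IsCompleteEvolutionAlgebra.exists_basis [FiniteDimensional ℂ E]
    (hE : IsCompleteEvolutionAlgebra E) (S : NonUnitalSubalgebra ℂ E) :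
    ∃ v : Basis (Fin (finrank ℂ E)) ℂ E, IsNatural v ∧
      ∀ x ∈ S, ∀ i, v.repr x i ≠ 0 → v i ∈ S := by
  obtain ⟨B, ⟨-, hsp, -⟩, B', hB', hsub⟩ := hE.2 S
  obtain ⟨v, hv, hrange⟩ := hB'.exists_basis
  refine ⟨v, hv, fun x hx i hi => ?_⟩
  have h1 : x ∈ Submodule.span ℂ ((fun x : S => (x : E)) '' B) := by
    have h2 : (⟨x, hx⟩ : S) ∈ Submodule.span ℂ B := hsp ▸ Submodule.mem_top
    have h3 := Submodule.mem_map_of_mem (f := S.toSubmodule.subtype) h2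
    rw [Submodule.map_span] at h3
    exact h3
  have h2 : (fun x : S => (x : E)) '' B ⊆ v '' {j | v j ∈ S} := by
    rintro _ ⟨b, hb, rfl⟩
    obtain ⟨j, hj⟩ : (b : E) ∈ Set.range v := hrange ▸ hsub ⟨b, hb, rfl⟩
    exact ⟨j, by simp [hj], hj⟩
  have h3 := (v.mem_span_image).1 (Submodule.span_mono h2 h1)
  exact h3 (by simpa using hi)

variable [IsScalarTower ℂ E E] [SMulCommClass ℂ E E]

section

variable {ι : Type*} [Fintype ι] {v : Basis ι ℂ E}

theorem IsNatural.mul_eq (hv : IsNatural v) (x y : E) :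
    x * y = ∑ i, (v.repr x i * v.repr y i) • (v i * v i) := by
  conv_lhs => rw [← v.sum_repr x, ← v.sum_repr y, Finset.sum_mul_sum]
  refine Finset.sum_congr rfl fun i _ => ?_
  rw [Finset.sum_eq_single i]
  · rw [smul_mul_smul_comm]
  · intro j _ hj
    rw [smul_mul_smul_comm, hv hj.symm, smul_zero]
  · simp

theorem IsNatural.mul_comm (hv : IsNatural v) (x y : E) : x * y = y * x := by
  rw [hv.mul_eq x y, hv.mul_eq y x]
  simp only [_root_.mul_comm]

theorem IsNatural.mul_basis (hv : IsNatural v) (x : E) (i : ι) :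
    x * v i = v.repr x i • (v i * v i) := by
  classical
  rw [hv.mul_eq, Finset.sum_eq_single i] <;> simp +contextual [eq_comm]

end

theorem IsEvolutionAlgebra.mul_comm [FiniteDimensional ℂ E] (hE : IsEvolutionAlgebra E) (x y : E) :
    x * y = y * x := by
  obtain ⟨v, hv⟩ := hE.exists_basis
  exact hv.mul_comm x y

variable (E) in
/-- The property that for any subalgebra `S`, the products of elements of `S` with arbitrary
elements of the algebra are combinations of products of elements of `S`. -/
def IsAbsorbing : Prop :=
  ∀ S W : Submodule ℂ E, (∀ a ∈ S, ∀ b ∈ S, a * b ∈ S) → (∀ a ∈ S, a * a ∈ W) →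
    ∀ x ∈ S, ∀ y, x * y ∈ W

theorem IsCompleteEvolutionAlgebra.isAbsorbing [FiniteDimensional ℂ E]
    (hE : IsCompleteEvolutionAlgebra E) : IsAbsorbing E := by
  intro S W hS hW x hx y
  obtain ⟨v, hv, hvS⟩ := hE.exists_basis
    { S with mul_mem' := fun {a b} ha hb => hS a ha b hb }
  rw [hv.mul_eq]
  refine W.sum_mem fun i _ => ?_
  by_cases h : v.repr x i = 0
  · simp [h]
  · exact W.smul_mem _ (hW _ (hvS x hx i h))

variable (E) in
/-- The ascending annihilator series of an algebra. -/
def annSeries : ℕ → Submodule ℂ E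
  | 0 => ⊥
  | k + 1 =>
    { carrier := {x | ∀ y, x * y ∈ annSeries k}
      add_mem' := fun {a b} ha hb y => by
        rw [add_mul]; exact (annSeries k).add_mem (ha y) (hb y)
      zero_mem' := fun y => by rw [zero_mul]; exact (annSeries k).zero_mem
      smul_mem' := fun c x hx y => by
        rw [smul_mul_assoc]; exact (annSeries k).smul_mem c (hx y) }

theorem mem_annSeries_zero {x : E} : x ∈ annSeries E 0 ↔ x = 0 := Submodule.mem_bot ℂ

theorem annSeries_le_succ (k : ℕ) : annSeries E k ≤ annSeries E (k + 1) := by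
  induction k with
  | zero => exact bot_le
  | succ k ih => exact fun x hx y => ih (hx y)

theorem annSeries_mono : Monotone (annSeries E) := monotone_nat_of_le_succ annSeries_le_succ

theorem mul_mem_annSeries {k : ℕ} {x : E} (hx : x ∈ annSeries E k) (y : E) :
    x * y ∈ annSeries E (k - 1) := by
  cases k with
  | zero => rw [mem_annSeries_zero] at hx; simp [hx]
  | succ k => exact hx y

theorem mul_mem_annSeries' {k : ℕ} {x : E} (hx : x ∈ annSeries E k) (y : E) :
    x * y ∈ annSeries E k := annSeries_mono (Nat.sub_le k 1) (mul_mem_annSeries hx y)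

theorem IsNatural.basis_mem_annSeries {ι : Type*} [Fintype ι] {v : Basis ι ℂ E}
    (hv : IsNatural v) {k : ℕ} {i : ι} (h : v i * v i ∈ annSeries E k) :
    v i ∈ annSeries E (k + 1) := by
  intro y
  rw [hv.mul_comm, hv.mul_basis]
  exact Submodule.smul_mem _ _ h

/-- Multiplying `x` by `v i` isolates a nonzero multiple of `v i * v i`. Hence every term of the
series is spanned by members of the natural basis. -/
theorem IsNatural.mem_annSeries_of_repr_ne_zero {ι : Type*} [Fintype ι] {v : Basis ι ℂ E}
    (hv : IsNatural v) {k : ℕ} {x : E} (hx : x ∈ annSeries E k) {i : ι} (hi : v.repr x i ≠ 0) :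
    v i ∈ annSeries E k := by
  cases k with
  | zero => rw [mem_annSeries_zero] at hx; simp [hx] at hi
  | succ k =>
    apply hv.basis_mem_annSeries
    have h := hx (v i)
    rw [hv.mul_basis] at h
    exact ((annSeries E k).smul_mem_iff hi).1 h

end NaturalBases

/-! ### Nonzero solutions of the quadratic systems that define idempotents. -/

section QuadraticSystems

variable {T : Type*} [Fintype T]

open Classical in
/-- A functional on monomials which is invariant under the rewriting rules
`X i ^ 2 ↦ ∑ l, N i l * X l`; on squarefree monomials it is the coefficient of `X k`. -/
noncomputable def rewriteFunctional (N : Matrix T T ℂ) (k : T) (m : T →₀ ℕ) : ℂ :=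
  if h : ∃ i, 2 ≤ m i then
    ∑ l, N h.choose l * rewriteFunctional N k
      (m - Finsupp.single h.choose 2 + Finsupp.single l 1)
  else if m = Finsupp.single k 1 then 1 else 0
termination_by m.degree
decreasing_by
  have h1 : m - Finsupp.single h.choose 2 + Finsupp.single h.choose 2 = m :=
    tsub_add_cancel_of_le (Finsupp.single_le_iff.2 h.choose_spec)
  have h2 := congrArg Finsupp.degree h1
  simp only [map_add, Finsupp.degree_single] at h2 ⊢
  omega

/-- Confluence: the definition rewrites at an arbitrarily chosen index, but rewritings at two
different indices commute, so any index gives the same value. -/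
theorem rewriteFunctional_add_single (N : Matrix T T ℂ) (k : T) (m : T →₀ ℕ) (i : T) :
    rewriteFunctional N k (m + Finsupp.single i 2) =
      ∑ l, N i l * rewriteFunctional N k (m + Finsupp.single l 1) := by
  classical
  induction hd : m.degree using Nat.strong_induction_on generalizing m i with
  | _ d ih =>
    have h : ∃ j, 2 ≤ (m + Finsupp.single i 2 : T →₀ ℕ) j := ⟨i, by simp⟩
    rw [rewriteFunctional, dif_pos h]
    have hj := h.choose_spec
    generalize h.choose = j at hj
    by_cases hij : j = i
    · subst hij
      simp
    · have hmj : 2 ≤ m j := by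
        simpa [Finsupp.single_apply, Ne.symm hij] using hj
      obtain ⟨b, rfl⟩ : ∃ b, m = b + Finsupp.single j 2 :=
        ⟨m - Finsupp.single j 2, (tsub_add_cancel_of_le (Finsupp.single_le_iff.2 hmj)).symm⟩
      have hdeg : ∀ l, (b + Finsupp.single l 1).degree < d := by
        intro l
        simp only [map_add, Finsupp.degree_single] at hd ⊢
        omega
      have e1 : ∀ l, b + Finsupp.single j 2 + Finsupp.single i 2 - Finsupp.single j 2 +
          Finsupp.single l 1 = b + Finsupp.single l 1 + Finsupp.single i 2 := by
        intro l
        rw [add_right_comm b, add_tsub_cancel_right, add_right_comm]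
      have e2 : ∀ l, b + Finsupp.single j 2 + Finsupp.single l 1 =
          b + Finsupp.single l 1 + Finsupp.single j 2 := fun l => add_right_comm _ _ _
      simp only [e1, e2]
      simp only [ih _ (hdeg _) _ _ rfl, Finset.mul_sum]
      rw [Finset.sum_comm]
      refine Finset.sum_congr rfl fun a _ => Finset.sum_congr rfl fun c _ => ?_
      rw [add_right_comm b]
      ring

/-- The linear extension of `rewriteFunctional` to polynomials. -/
noncomputable def rewriteLinear (N : Matrix T T ℂ) (k : T) : MvPolynomial T ℂ →ₗ[ℂ] ℂ :=
  (MvPolynomial.basisMonomials T ℂ).constr ℂ (rewriteFunctional N k)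

theorem rewriteLinear_monomial (N : Matrix T T ℂ) (k : T) (m : T →₀ ℕ) (c : ℂ) :
    rewriteLinear N k (MvPolynomial.monomial m c) = c * rewriteFunctional N k m := by
  have h := (MvPolynomial.basisMonomials T ℂ).constr_basis ℂ (rewriteFunctional N k) m
  rw [MvPolynomial.coe_basisMonomials] at h
  rw [← mul_one c, ← smul_eq_mul c, ← MvPolynomial.smul_monomial, map_smul]
  simp only [rewriteLinear, h, smul_eq_mul, mul_one]

/-- The polynomials `X j ^ 2 - ∑ l, N j l * X l`. -/
noncomputable def quadPoly (N : Matrix T T ℂ) (j : T) : MvPolynomial T ℂ :=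
  MvPolynomial.X j ^ 2 - ∑ l, MvPolynomial.C (N j l) * MvPolynomial.X l

theorem rewriteLinear_mul_quadPoly (N : Matrix T T ℂ) (k j : T) (p : MvPolynomial T ℂ) :
    rewriteLinear N k (p * quadPoly N j) = 0 := by
  induction p using MvPolynomial.induction_on' with
  | add p q hp hq => rw [add_mul, map_add, hp, hq, add_zero]
  | monomial m c =>
    have h : MvPolynomial.monomial m c * quadPoly N j =
        MvPolynomial.monomial (m + Finsupp.single j 2) c -
          ∑ l, MvPolynomial.monomial (m + Finsupp.single l 1) (c * N j l) := by
      rw [quadPoly, mul_sub, Finset.mul_sum, MvPolynomial.X_pow_eq_monomial,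
        MvPolynomial.monomial_mul, mul_one]
      congr 1
      refine Finset.sum_congr rfl fun l _ => ?_
      rw [MvPolynomial.X, MvPolynomial.C_mul_monomial, MvPolynomial.monomial_mul, mul_one]
    rw [h, map_sub, map_sum]
    simp only [rewriteLinear_monomial, rewriteFunctional_add_single, Finset.mul_sum, mul_assoc,
      sub_self]

/-- `rewriteLinear N k` vanishes on the ideal and equals 1 at `X k`. -/
theorem X_notMem_span_quadPoly (N : Matrix T T ℂ) (k : T) :
    MvPolynomial.X k ∉ Ideal.span (Set.range (quadPoly N)) := by
  intro h
  obtain ⟨c, hc⟩ := Ideal.mem_span_range_iff_exists_fun.1 h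
  have h1 := congrArg (rewriteLinear N k) hc
  rw [map_sum] at h1
  simp only [rewriteLinear_mul_quadPoly, Finset.sum_const_zero] at h1
  rw [MvPolynomial.X, rewriteLinear_monomial, rewriteFunctional, dif_neg] at h1
  · simp at h1
  · rintro ⟨i, hi⟩
    classical
    rw [Finsupp.single_apply] at hi
    split_ifs at hi <;> omega

/-- If 0 were the only zero, the Nullstellensatz would put a power of the ideal `a` of the origin
inside `I`. Invertibility of `N` makes 0 a simple zero, that is `a ≤ I ⊔ a ^ 2`; iterating gives `a
≤ I`, although no variable lies in `I`. -/
theorem exists_ne_zero_forall_sq_eq [DecidableEq T] [Nonempty T] (N : Matrix T T ℂ)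
    (hN : IsUnit N.det) :
    ∃ x : T → ℂ, x ≠ 0 ∧ ∀ j, x j ^ 2 = ∑ l, N j l * x l := by
  by_contra! hcon
  set I : Ideal (MvPolynomial T ℂ) := Ideal.span (Set.range (quadPoly N)) with hI
  set a : Ideal (MvPolynomial T ℂ) := Ideal.span (Set.range MvPolynomial.X) with ha
  have hq : ∀ j, quadPoly N j ∈ I := fun j => Ideal.subset_span ⟨j, rfl⟩
  have hX : ∀ j, MvPolynomial.X j ∈ a := fun j => Ideal.subset_span ⟨j, rfl⟩
  have hrad : a ≤ I.radical := by
    rw [← MvPolynomial.vanishingIdeal_zeroLocus_eq_radical (K := ℂ) I, ha, Ideal.span_le]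
    rintro _ ⟨k, rfl⟩
    rw [SetLike.mem_coe, MvPolynomial.mem_vanishingIdeal_iff]
    intro x hx
    have hx0 : x = 0 := by
      by_contra hne
      obtain ⟨j, hj⟩ := hcon x hne
      have := MvPolynomial.mem_zeroLocus_iff.1 hx _ (hq j)
      simp only [quadPoly, map_sub, map_pow, MvPolynomial.aeval_X, map_sum, map_mul,
        MvPolynomial.algHom_C, Algebra.algebraMap_self, RingHom.id_apply] at this
      exact hj (sub_eq_zero.1 this)
    simp [hx0]
  obtain ⟨r, hr⟩ := Ideal.exists_radical_pow_le_of_fg I (IsNoetherian.noetherian _)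
  have hsq : a ≤ I ⊔ a ^ 2 := by
    conv_lhs => rw [ha]
    rw [Ideal.span_le]
    rintro _ ⟨k, rfl⟩
    have h1 : ∀ j, ∑ l, MvPolynomial.C (N j l) * MvPolynomial.X l ∈ I ⊔ a ^ 2 := by
      intro j
      have : ∑ l, MvPolynomial.C (N j l) * MvPolynomial.X l =
          -quadPoly N j + MvPolynomial.X j ^ 2 := by rw [quadPoly]; ring
      rw [this]
      exact add_mem (Ideal.mem_sup_left (I.neg_mem (hq j)))
        (Ideal.mem_sup_right (Ideal.pow_mem_pow (hX j) 2))
    have h2 : (MvPolynomial.X k : MvPolynomial T ℂ) =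
        ∑ j, MvPolynomial.C (N⁻¹ k j) * ∑ l, MvPolynomial.C (N j l) * MvPolynomial.X l := by
      simp only [Finset.mul_sum, ← mul_assoc, ← MvPolynomial.C_mul]
      rw [Finset.sum_comm]
      simp only [← Finset.sum_mul, ← map_sum, ← Matrix.mul_apply, Matrix.nonsing_inv_mul N hN]
      simp [Matrix.one_apply]
    rw [SetLike.mem_coe, h2]
    exact sum_mem fun j _ => Ideal.mul_mem_left _ _ (h1 j)
  have hpow : ∀ m : ℕ, a ≤ I ⊔ a ^ (m + 1) := by
    intro m
    induction m with
    | zero => simp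
    | succ m ih =>
      refine hsq.trans (sup_le le_sup_left ?_)
      rw [pow_two]
      refine (Ideal.mul_mono_right ih).trans ?_
      rw [Ideal.mul_sup, ← pow_succ']
      exact sup_le_sup_right Ideal.mul_le_right _
  have haI : a ≤ I := by
    refine (hpow r).trans (sup_le le_rfl ?_)
    exact (Ideal.pow_right_mono hrad _).trans ((Ideal.pow_le_pow_right (Nat.le_succ r)).trans hr)
  obtain ⟨k⟩ := ‹Nonempty T›
  exact X_notMem_span_quadPoly N k (haI (hX k))

theorem exists_ne_zero_sq_vecMul_eq [DecidableEq T] [Nonempty T] (M : Matrix T T ℂ)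
    (hM : ∀ c : T → ℂ, (∀ k, ∑ j, c j * M j k = 0) → c = 0) :
    ∃ x : T → ℂ, x ≠ 0 ∧ ∀ k, ∑ j, x j ^ 2 * M j k = x k := by
  have hdet : IsUnit M.det := by
    rw [isUnit_iff_ne_zero]
    intro h0
    obtain ⟨c, hc, hc0⟩ := Matrix.exists_vecMul_eq_zero_iff.2 h0
    exact hc (hM c fun k => congrFun hc0 k)
  obtain ⟨x, hx, hsq⟩ := exists_ne_zero_forall_sq_eq M⁻¹.transpose
    (by rw [Matrix.det_transpose]; exact Matrix.isUnit_nonsing_inv_det M hdet)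
  refine ⟨x, hx, fun k => ?_⟩
  have h : Matrix.vecMul (fun j => x j ^ 2) M = x := by
    have : (fun j => x j ^ 2) = Matrix.vecMul x M⁻¹ := by
      ext j
      rw [hsq j]
      simp [Matrix.vecMul, dotProduct, mul_comm]
    rw [this, Matrix.vecMul_vecMul, Matrix.nonsing_inv_mul M hdet, Matrix.vecMul_one]
  exact congrFun h k

end QuadraticSystems

/-! ### Consequences of absorption modulo an ideal `J`. -/

section AbsorbingAlgebras

variable {E : Type*} [NonUnitalNonAssocRing E] [Module ℂ E] [IsScalarTower ℂ E E]
  [SMulCommClass ℂ E E] {J : Submodule ℂ E}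

theorem Submodule.mem_sup_span_singleton' {x y : E} :
    y ∈ J ⊔ Submodule.span ℂ {x} ↔ ∃ z ∈ J, ∃ c : ℂ, z + c • x = y := by
  simp only [Submodule.mem_sup, Submodule.mem_span_singleton, exists_exists_eq_and]

/-- Absorption for the subalgebra J + ℂx, all of whose products lie in `J`. The next two lemmas use
J + ℂx² + ℂx and J + ℂx in the same way. -/
theorem IsAbsorbing.mul_mem_of_sq_mem (hE : IsAbsorbing E) (hc : ∀ x y : E, x * y = y * x)
    (hJ : ∀ x ∈ J, ∀ y, x * y ∈ J) {x : E} (hx : x * x ∈ J) (y : E) : x * y ∈ J := by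
  have key : ∀ a ∈ J ⊔ Submodule.span ℂ {x}, ∀ b ∈ J ⊔ Submodule.span ℂ {x}, a * b ∈ J := by
    intro a ha b hb
    obtain ⟨z, hz, c, rfl⟩ := Submodule.mem_sup_span_singleton'.1 ha
    obtain ⟨z', hz', c', rfl⟩ := Submodule.mem_sup_span_singleton'.1 hb
    rw [add_mul, mul_add (c • x), smul_mul_smul_comm, hc (c • x) z']
    exact J.add_mem (hJ z hz _) (J.add_mem (hJ z' hz' _) (J.smul_mem _ hx))
  exact hE (J ⊔ Submodule.span ℂ {x}) J (fun a ha b hb => Submodule.mem_sup_left (key a ha b hb))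
    (fun a ha => key a ha a ha) x
    (Submodule.mem_sup_right (Submodule.mem_span_singleton_self x)) y

theorem IsAbsorbing.mul_mem_sup_span_sq (hE : IsAbsorbing E) (hc : ∀ x y : E, x * y = y * x)
    (hJ : ∀ x ∈ J, ∀ y, x * y ∈ J) {x : E} (hx : ∀ y, x * x * y ∈ J) (y : E) :
    x * y ∈ J ⊔ Submodule.span ℂ {x * x} := by
  set W := J ⊔ Submodule.span ℂ {x * x} with hW
  have hWJ : ∀ w ∈ W, ∀ y, w * y ∈ J := by
    intro w hw y
    obtain ⟨z, hz, c, rfl⟩ := Submodule.mem_sup_span_singleton'.1 hw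
    rw [add_mul, smul_mul_assoc]
    exact J.add_mem (hJ z hz _) (J.smul_mem _ (hx y))
  have key : ∀ a ∈ W ⊔ Submodule.span ℂ {x}, ∀ b ∈ W ⊔ Submodule.span ℂ {x}, a * b ∈ W := by
    intro a ha b hb
    obtain ⟨z, hz, c, rfl⟩ := Submodule.mem_sup_span_singleton'.1 ha
    obtain ⟨z', hz', c', rfl⟩ := Submodule.mem_sup_span_singleton'.1 hb
    rw [add_mul, mul_add (c • x), smul_mul_smul_comm, hc (c • x) z']
    exact W.add_mem (Submodule.mem_sup_left (hWJ z hz _))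
      (W.add_mem (Submodule.mem_sup_left (hWJ z' hz' _))
        (W.smul_mem _ (Submodule.mem_sup_right (Submodule.mem_span_singleton_self _))))
  exact hE (W ⊔ Submodule.span ℂ {x}) W (fun a ha b hb => Submodule.mem_sup_left (key a ha b hb))
    (fun a ha => key a ha a ha) x
    (Submodule.mem_sup_right (Submodule.mem_span_singleton_self x)) y

theorem IsAbsorbing.mul_mem_sup_span_of_idempotent (hE : IsAbsorbing E)
    (hc : ∀ x y : E, x * y = y * x) (hJ : ∀ x ∈ J, ∀ y, x * y ∈ J) {x : E} (hx : x * x - x ∈ J)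
    (y : E) : x * y ∈ J ⊔ Submodule.span ℂ {x} := by
  set S := J ⊔ Submodule.span ℂ {x} with hS
  have hxx : x * x ∈ S := by
    rw [← sub_add_cancel (x * x) x]
    exact S.add_mem (Submodule.mem_sup_left hx)
      (Submodule.mem_sup_right (Submodule.mem_span_singleton_self x))
  have key : ∀ a ∈ S, ∀ b ∈ S, a * b ∈ S := by
    intro a ha b hb
    obtain ⟨z, hz, c, rfl⟩ := Submodule.mem_sup_span_singleton'.1 ha
    obtain ⟨z', hz', c', rfl⟩ := Submodule.mem_sup_span_singleton'.1 hb
    rw [add_mul, mul_add (c • x), smul_mul_smul_comm, hc (c • x) z']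
    exact S.add_mem (Submodule.mem_sup_left (hJ z hz _))
      (S.add_mem (Submodule.mem_sup_left (hJ z' hz' _)) (S.smul_mem _ hxx))
  exact hE S S key (fun a ha => key a ha a ha) x
    (Submodule.mem_sup_right (Submodule.mem_span_singleton_self x)) y

variable {ι : Type*} [Fintype ι] {v : Basis ι ℂ E}

/-- With square roots `s i` of the coefficients, the sum is the square of x = ∑ s_i v_i; by
absorption `J` then contains every x v_i = s_i v_i². -/
theorem IsNatural.smul_sq_mem_of_sum_mem (hv : IsNatural v) (hE : IsAbsorbing E)
    (hJ : ∀ x ∈ J, ∀ y, x * y ∈ J) {c : ι → ℂ} (hc : ∑ i, c i • (v i * v i) ∈ J) (i : ι) :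
    c i • (v i * v i) ∈ J := by
  choose s hs using fun i => IsAlgClosed.exists_pow_nat_eq (c i) two_pos
  have hrepr : ∀ i, v.repr (∑ i, s i • v i) i = s i := fun i => by rw [v.repr_sum_self]
  have hsq : (∑ i, s i • v i) * (∑ i, s i • v i) ∈ J := by
    rw [hv.mul_eq]
    simpa only [hrepr, ← pow_two, hs] using hc
  have h := hE.mul_mem_of_sq_mem hv.mul_comm hJ hsq (v i)
  rw [hv.mul_basis, hrepr] at h
  rw [← hs, pow_two, mul_smul]
  exact J.smul_mem _ h

theorem IsNatural.smul_sq_mem_of_add_mem (hv : IsNatural v) (hE : IsAbsorbing E)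
    (hJ : ∀ x ∈ J, ∀ y, x * y ∈ J) {i j : ι} (hij : i ≠ j) {a b : ℂ}
    (h : a • (v i * v i) + b • (v j * v j) ∈ J) :
    a • (v i * v i) ∈ J ∧ b • (v j * v j) ∈ J := by
  classical
  have h' : ∑ l, (Pi.single i a + Pi.single j b : ι → ℂ) l • (v l * v l) ∈ J := by
    simpa [add_smul, Finset.sum_add_distrib, Pi.single_apply, ite_smul] using h
  have h1 := hv.smul_sq_mem_of_sum_mem hE hJ h' i
  have h2 := hv.smul_sq_mem_of_sum_mem hE hJ h' j
  simp only [Pi.add_apply, Pi.single_eq_same, Pi.single_eq_of_ne hij, add_zero] at h1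
  simp only [Pi.add_apply, Pi.single_eq_same, Pi.single_eq_of_ne hij.symm, zero_add] at h2
  exact ⟨h1, h2⟩

/-- The basis vectors in a given step of the annihilator series, but not in the previous one,
are unique, except in the first step. -/
theorem IsNatural.eq_of_mem_annSeries (hv : IsNatural v) (hE : IsAbsorbing E) {k : ℕ} {i j : ι}
    (hi : v i ∈ annSeries E (k + 2)) (hi' : v i ∉ annSeries E (k + 1))
    (hj : v j ∈ annSeries E (k + 2)) (hj' : v j ∉ annSeries E (k + 1)) : i = j := by
  by_contra hij
  have hJ : ∀ x ∈ annSeries E k, ∀ y, x * y ∈ annSeries E k := fun x hx => mul_mem_annSeries' hx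
  have hij' : v i * v j = 0 := hv hij
  have hji' : v j * v i = 0 := hv (Ne.symm hij)
  have hx : v i + v j ∈ annSeries E (k + 2) := Submodule.add_mem _ hi hj
  -- Here (v_i + v_j) v_i = v_i² must be a multiple of v_i² + v_j² modulo Z_k, which is a relation
  -- between the two squares.
  have h := hE.mul_mem_sup_span_sq hv.mul_comm hJ (fun y => hx (v i + v j) y) (v i)
  obtain ⟨z, hz, c, hzc⟩ := Submodule.mem_sup_span_singleton'.1 h
  have h2 : (1 - c) • (v i * v i) + (-c) • (v j * v j) ∈ annSeries E k := by
    have : (1 - c) • (v i * v i) + (-c) • (v j * v j) = z := by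
      simp only [add_mul, mul_add, hij', hji', add_zero, zero_add] at hzc
      rw [eq_sub_of_add_eq hzc]
      module
    rwa [this]
  obtain ⟨h3, h4⟩ := hv.smul_sq_mem_of_add_mem hE hJ hij h2
  by_cases hc : c = 0
  · subst hc
    rw [sub_zero, one_smul] at h3
    exact hi' (hv.basis_mem_annSeries h3)
  · exact hj' (hv.basis_mem_annSeries (((annSeries E k).smul_mem_iff (neg_ne_zero.2 hc)).1 h4))

/-- `hJ'` says that E/J has zero annihilator, which is what stability of the annihilator series
provides. -/
theorem IsNatural.basis_mem_of_sq_mem (hv : IsNatural v) (hJ' : ∀ x, (∀ y, x * y ∈ J) → x ∈ J)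
    {i : ι} {c : ℂ} (hc : c ≠ 0) (h : c • (v i * v i) ∈ J) : v i ∈ J := by
  refine hJ' _ fun y => ?_
  rw [hv.mul_comm, hv.mul_basis]
  exact J.smul_mem _ ((J.smul_mem_iff hc).1 h)

/-- An idempotent modulo `J` has at most one nonzero coordinate outside of `J`. -/
theorem IsNatural.eq_of_repr_ne_zero (hv : IsNatural v) (hE : IsAbsorbing E)
    (hJ : ∀ x ∈ J, ∀ y, x * y ∈ J) (hJ' : ∀ x, (∀ y, x * y ∈ J) → x ∈ J) {x : E}
    (hx : x * x - x ∈ J) {i j : ι} (hi : v i ∉ J) (hj : v j ∉ J) (hxi : v.repr x i ≠ 0)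
    (hxj : v.repr x j ≠ 0) : i = j := by
  by_contra hij
  have h : ∀ l, v.repr x l ≠ 0 → ∃ z ∈ J, ∃ c : ℂ, z + c • x = v l * v l := by
    intro l hl
    have h1 := hE.mul_mem_sup_span_of_idempotent hv.mul_comm hJ hx (v l)
    rw [hv.mul_basis, Submodule.smul_mem_iff _ hl] at h1
    exact Submodule.mem_sup_span_singleton'.1 h1
  obtain ⟨z, hz, a, ha⟩ := h i hxi
  obtain ⟨z', hz', b, hb⟩ := h j hxj
  -- Both squares are multiples of `x` modulo `J`, hence linearly dependent there.
  have h1 : b • (v i * v i) + (-a) • (v j * v j) ∈ J := by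
    have : b • (v i * v i) + (-a) • (v j * v j) = b • z + (-a) • z' := by
      rw [← ha, ← hb, smul_add, smul_add, smul_smul, smul_smul, neg_mul, _root_.mul_comm b a, neg_smul,
        neg_smul]
      abel
    rw [this]
    exact J.add_mem (J.smul_mem _ hz) (J.smul_mem _ hz')
  obtain ⟨-, h3⟩ := hv.smul_sq_mem_of_add_mem hE hJ hij h1
  by_cases ha0 : a = 0
  · refine hi (hv.basis_mem_of_sq_mem hJ' one_ne_zero ?_)
    rw [one_smul, ← ha, ha0, zero_smul, add_zero]
    exact hz
  · exact hj (hv.basis_mem_of_sq_mem hJ' (neg_ne_zero.2 ha0) h3)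

/-- Existence of idempotents modulo `W` which are combinations of basis vectors outside of `W`. -/
theorem IsNatural.exists_idempotent_mod (hv : IsNatural v) (W : Submodule ℂ E) (p : ι → Prop)
    (hp : ∃ i, p i) (hW : ∀ i, ¬ p i → v i ∈ W)
    (hind : ∀ c : ι → ℂ, (∀ i, ¬ p i → c i = 0) → ∑ i, c i • (v i * v i) ∈ W → c = 0) :
    ∃ y, (∀ i, ¬ p i → v.repr y i = 0) ∧ (∃ i, p i ∧ v.repr y i ≠ 0) ∧ y * y - y ∈ W := by
  classical
  obtain ⟨i₀, hi₀⟩ := hp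
  have : Nonempty {i // p i} := ⟨⟨i₀, hi₀⟩⟩
  have hdec : ∀ z : E, z - ∑ k : {i // p i}, v.repr z k • v k ∈ W := by
    intro z
    have h := Fintype.sum_subtype_add_sum_subtype p (fun i => v.repr z i • v i)
    rw [v.sum_repr] at h
    have h' : z - ∑ k : {i // p i}, v.repr z k • v k =
        ∑ k : {i // ¬ p i}, v.repr z k • v k := by
      rw [sub_eq_iff_eq_add, add_comm]; exact h.symm
    rw [h']
    exact W.sum_mem fun k _ => W.smul_mem _ (hW k k.2)
  have hsub : ∀ (c : ι → ℂ) (f : ι → E), (∀ i, ¬ p i → c i = 0) →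
      ∑ i, c i • f i = ∑ i : {i // p i}, c i • f i := by
    intro c f hc
    rw [← Fintype.sum_subtype_add_sum_subtype p, add_eq_left]
    exact Finset.sum_eq_zero fun i _ => by rw [hc i i.2, zero_smul]
  have hcomb : ∀ c : {i // p i} → ℂ,
      ∑ j, c j • (v j * v j) - ∑ k : {i // p i}, (∑ j, c j * v.repr (v j * v j) k) • v k ∈ W := by
    intro c
    have : ∑ j, c j • (v j * v j) -
          ∑ k : {i // p i}, (∑ j, c j * v.repr (v j * v j) k) • v k =
        ∑ j, c j • (v j * v j - ∑ k : {i // p i}, v.repr (v j * v j) k • v k) := by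
      simp only [smul_sub, Finset.sum_sub_distrib, Finset.smul_sum, Finset.sum_smul, smul_smul]
      rw [Finset.sum_comm]
    rw [this]
    exact W.sum_mem fun j _ => W.smul_mem _ (hdec _)
  -- The matrix expresses the squares v_j² modulo `W` in the basis vectors selected by `p`; `hind`
  -- makes its rows independent.
  obtain ⟨x, hx, hsq⟩ := exists_ne_zero_sq_vecMul_eq
    (Matrix.of fun j k : {i // p i} => v.repr (v j * v j) k) (by
      intro c hc
      simp only [Matrix.of_apply] at hc
      have h := hcomb c
      simp only [hc, zero_smul, Finset.sum_const_zero, sub_zero] at h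
      have hext : ∀ i : {i // p i}, (if h : p i then c ⟨i, h⟩ else 0) = c i := fun i => by
        rw [dif_pos i.2]
      have h2 := hind (fun i => if h : p i then c ⟨i, h⟩ else 0) (fun i hi => dif_neg hi)
        (by
          rw [hsub (fun i => if h : p i then c ⟨i, h⟩ else 0) _ (fun i hi => dif_neg hi)]
          simpa only [hext] using h)
      ext i
      exact (hext i).symm.trans (congrFun h2 i))
  simp only [Matrix.of_apply] at hsq
  set c : ι → ℂ := fun i => if h : p i then x ⟨i, h⟩ else 0 with hcdef
  have hc0 : ∀ i, ¬ p i → c i = 0 := fun i hi => dif_neg hi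
  have hcx : ∀ i : {i // p i}, c i = x i := fun i => dif_pos i.2
  have hrepr : ∀ i, v.repr (∑ i, c i • v i) i = c i := fun i => by rw [v.repr_sum_self]
  refine ⟨∑ i, c i • v i, fun i hi => by rw [hrepr, hc0 i hi], ?_, ?_⟩
  · obtain ⟨i, hi⟩ := Function.ne_iff.1 hx
    exact ⟨i, i.2, by rw [hrepr, hcx]; exact hi⟩
  · rw [hv.mul_eq]
    simp only [hrepr, ← pow_two (c _)]
    rw [hsub c _ hc0, hsub (fun i => c i ^ 2) _ (fun i hi => by simp [hc0 i hi])]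
    have h := hcomb (fun j => x j ^ 2)
    simp only [hsq] at h
    simpa only [hcx] using h

theorem IsNatural.exists_idempotent_mod_of_notMem (hv : IsNatural v) (hE : IsAbsorbing E)
    (hJ : ∀ x ∈ J, ∀ y, x * y ∈ J) (hJ' : ∀ x, (∀ y, x * y ∈ J) → x ∈ J) {i : ι} (hi : v i ∉ J) :
    ∃ y, (∀ i, v i ∈ J → v.repr y i = 0) ∧ (∃ i, v i ∉ J ∧ v.repr y i ≠ 0) ∧ y * y - y ∈ J := by
  obtain ⟨y, h1, h2⟩ := hv.exists_idempotent_mod J (fun i => v i ∉ J) ⟨i, hi⟩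
    (fun i hi => not_not.1 hi) (fun c hc0 hc => by
      ext j
      by_contra hj
      exact hj (hc0 j (not_not.2 (hv.basis_mem_of_sq_mem hJ' hj
        (hv.smul_sq_mem_of_sum_mem hE hJ hc j)))))
  exact ⟨y, fun i hi => h1 i (not_not.2 hi), h2⟩

/-- The two roots have sum 1, so they are not both zero. -/
theorem exists_ne_zero_sq_sub_add_eq_zero (d : ℂ) : ∃ t : ℂ, t ≠ 0 ∧ d + t ^ 2 - t = 0 := by
  by_cases hd : d = 0
  · exact ⟨1, one_ne_zero, by simp [hd]⟩
  · obtain ⟨s, hs⟩ := IsAlgClosed.exists_pow_nat_eq (1 - 4 * d) two_pos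
    refine ⟨(1 + s) / 2, fun h => hd ?_, by linear_combination hs / 4⟩
    linear_combination (1 - s) / 2 * h + hs / 4

/-- Outside of the limit of the annihilator series there is at most one natural basis vector. -/
theorem IsNatural.eq_of_notMem (hv : IsNatural v) (hE : IsAbsorbing E)
    (hJ : ∀ x ∈ J, ∀ y, x * y ∈ J) (hJ' : ∀ x, (∀ y, x * y ∈ J) → x ∈ J) {i j : ι}
    (hi : v i ∉ J) (hj : v j ∉ J) : i = j := by
  classical
  obtain ⟨e, he0, ⟨m, hm, hem⟩, he⟩ := hv.exists_idempotent_mod_of_notMem hE hJ hJ' hi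
  by_contra hij
  obtain ⟨q, hqJ, hqm⟩ : ∃ q, v q ∉ J ∧ q ≠ m := by
    by_cases him : i = m
    · exact ⟨j, hj, fun h => hij (him.trans h.symm)⟩
    · exact ⟨i, hi, him⟩
  set c := v.repr e m with hcdef
  -- An idempotent modulo `J` has one coordinate outside `J`, and `e` has none inside.
  have hec : e = c • v m := by
    apply v.repr.injective
    ext l
    rw [map_smul, v.repr_self, Finsupp.smul_apply, Finsupp.single_apply]
    split_ifs with h
    · simp [← h, hcdef]
    · rw [smul_zero]
      by_contra hl
      exact h (hv.eq_of_repr_ne_zero hE hJ hJ' he hm (fun hlJ => hl (he0 l hlJ)) hem hl)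
  have hvm : v m - c • (v m * v m) ∈ J := by
    rw [hec, smul_mul_smul_comm, mul_smul, ← smul_sub, Submodule.smul_mem_iff _ hem] at he
    rw [← neg_sub]
    exact J.neg_mem he
  -- A second idempotent, modulo J + ℂv_m and free of v_m. Independence holds because v_m ≡ c v_m²
  -- modulo `J`, which turns a relation modulo J + ℂv_m into one modulo `J`.
  obtain ⟨y, hy0, ⟨l, ⟨hlJ, hlm⟩, hyl⟩, hy⟩ := hv.exists_idempotent_mod
    (J ⊔ Submodule.span ℂ {v m}) (fun l => v l ∉ J ∧ l ≠ m) ⟨q, hqJ, hqm⟩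
    (fun l hl => by
      by_cases hlJ : v l ∈ J
      · exact Submodule.mem_sup_left hlJ
      · rw [not_and, not_not] at hl
        rw [hl hlJ]
        exact Submodule.mem_sup_right (Submodule.mem_span_singleton_self _))
    (fun d hd0 hd => by
      obtain ⟨z, hz, a, ha⟩ := Submodule.mem_sup_span_singleton'.1 hd
      have h1 : ∑ l, (d - Pi.single m (a * c) : ι → ℂ) l • (v l * v l) ∈ J := by
        have h2 : ∑ l, (d - Pi.single m (a * c) : ι → ℂ) l • (v l * v l) =
            z + a • (v m - c • (v m * v m)) := by
          have h3 : ∑ l, (d - Pi.single m (a * c) : ι → ℂ) l • (v l * v l) =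
              ∑ l, d l • (v l * v l) - (a * c) • (v m * v m) := by
            simp [sub_smul, Finset.sum_sub_distrib, Pi.single_apply, ite_smul]
          rw [h3, ← ha, smul_sub, smul_smul]
          abel
        rw [h2]
        exact J.add_mem hz (J.smul_mem _ hvm)
      ext l
      by_contra hl
      by_cases hp : v l ∉ J ∧ l ≠ m
      · have h3 := hv.smul_sq_mem_of_sum_mem hE hJ h1 l
        rw [Pi.sub_apply, Pi.single_eq_of_ne hp.2, sub_zero] at h3
        exact hp.1 (hv.basis_mem_of_sq_mem hJ' hl h3)
      · exact hl (hd0 l hp))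
  obtain ⟨z, hz, a, ha⟩ := Submodule.mem_sup_span_singleton'.1 hy
  -- Modulo `J`, y² = y + (a/c)e, y e = 0 and e² = e. This choice of `t` makes y + te idempotent
  -- modulo `J`, with nonzero coordinates at both `l` and `m`.
  obtain ⟨t, ht, htd⟩ := exists_ne_zero_sq_sub_add_eq_zero (a / c)
  have hym : v.repr y m = 0 := hy0 m (fun h => h.2 rfl)
  have hye : y * e = 0 := by rw [hec, mul_smul_comm, hv.mul_basis, hym, zero_smul, smul_zero]
  have hey : e * y = 0 := by rw [hv.mul_comm, hye]
  have hidem : (y + t • e) * (y + t • e) - (y + t • e) ∈ J := by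
    have h1 : (y + t • e) * (y + t • e) - (y + t • e) =
        z + t ^ 2 • (e * e - e) + (a / c + t ^ 2 - t) • e := by
      have h2 : a • v m = (a / c) • e := by
        rw [hec, smul_smul, div_mul_cancel₀ _ hem]
      rw [h2] at ha
      have h3 : y * y = y + (z + (a / c) • e) := by rw [ha]; abel
      simp only [add_mul, mul_add, mul_smul_comm, smul_mul_assoc, hye, hey, smul_zero, add_zero,
        zero_add, h3]
      module
    rw [h1, htd, zero_smul, add_zero]
    exact J.add_mem hz (J.smul_mem _ he)
  refine hlm (hv.eq_of_repr_ne_zero hE hJ hJ' hidem hlJ hm ?_ ?_)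
  · rw [map_add, Finsupp.add_apply, hec]
    simpa [Finsupp.single_apply, hlm.symm] using hyl
  · rw [map_add, Finsupp.add_apply, hym, hec]
    simpa [ht] using hem

/-- Squaring improves the approximation: with z = x² - x, the defect of x² is zx + z(x + z), one
step lower in the series. -/
theorem exists_idempotent_of_mod_annSeries {r k : ℕ} (hk : k ≤ r) {x : E}
    (hc : ∀ x y : E, x * y = y * x) (hx : x ∉ annSeries E r) (hxk : x * x - x ∈ annSeries E k) :
    ∃ e ∉ annSeries E r, e * e = e := by
  induction k generalizing x with
  | zero => exact ⟨x, hx, sub_eq_zero.1 (mem_annSeries_zero.1 hxk)⟩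
  | succ k ih =>
    refine ih (by omega) (x := x * x) (fun h => hx ?_) ?_
    · rw [← sub_sub_cancel (x * x) x]
      exact Submodule.sub_mem _ h (annSeries_mono hk hxk)
    · set z := x * x - x with hz
      have h1 : x * x = x + z := by rw [hz]; abel
      have h2 : x * x * (x * x) - x * x = z * x + z * (x + z) := by
        conv_lhs => rw [h1]
        rw [add_mul, mul_add x, h1, hc x z]
        abel
      rw [h2]
      exact Submodule.add_mem _ (hxk x) (hxk _)

end AbsorbingAlgebras

/-! ### Powers, the annihilator series and the bound on the index. -/

section Nilpotency

variable {A : Type*} [NonUnitalNonAssocRing A] [Module ℂ A] [IsScalarTower ℂ A A]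
  [SMulCommClass ℂ A A]

theorem algPower_one : algPower A 1 = ⊤ := by rw [algPower]

theorem algPower_add_two (k : ℕ) : algPower A (k + 2) = ⨆ i : Fin (k + 1),
    Submodule.map₂ (LinearMap.mul ℂ A) (algPower A (i + 1)) (algPower A (k + 1 - i)) := by
  rw [algPower]

theorem mul_mem_algPower {i j : ℕ} (hi : 1 ≤ i) (hj : 1 ≤ j) {x y : A} (hx : x ∈ algPower A i)
    (hy : y ∈ algPower A j) : x * y ∈ algPower A (i + j) := by
  obtain ⟨k, hk⟩ : ∃ k, i + j = k + 2 := ⟨i + j - 2, by omega⟩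
  rw [hk, algPower_add_two]
  refine Submodule.mem_iSup_of_mem ⟨i - 1, by omega⟩ ?_
  refine Submodule.apply_mem_map₂ (LinearMap.mul ℂ A) (m := x) (n := y) ?_ ?_
  · simpa only [Nat.sub_add_cancel hi] using hx
  · simpa only [show k + 1 - (i - 1) = j by omega] using hy

theorem algPower_le {k : ℕ} {W : Submodule ℂ A}
    (h : ∀ i j, 1 ≤ i → 1 ≤ j → i + j = k + 2 → ∀ x ∈ algPower A i, ∀ y ∈ algPower A j,
      x * y ∈ W) : algPower A (k + 2) ≤ W := by
  rw [algPower_add_two]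
  refine iSup_le fun i => Submodule.map₂_le.2 fun x hx y hy => ?_
  exact h _ _ (by omega) (by omega) (by omega) x hx y hy

theorem algPower_succ_le (k : ℕ) : algPower A (k + 1) ≤ algPower A k := by
  induction k using Nat.strong_induction_on with
  | _ k ih =>
    match k with
    | 0 => rw [algPower_one, algPower]
    | 1 => rw [algPower_one]; exact le_top
    | k + 2 =>
      refine algPower_le (k := k + 1) fun i j hi hj hij x hx y hy => ?_
      by_cases hi1 : i = 1
      · obtain ⟨j, rfl⟩ : ∃ l, j = l + 1 := ⟨j - 1, by omega⟩
        rw [show k + 2 = i + j by omega]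
        exact mul_mem_algPower hi (by omega) hx (ih j (by omega) hy)
      · obtain ⟨i, rfl⟩ : ∃ l, i = l + 1 := ⟨i - 1, by omega⟩
        rw [show k + 2 = i + j by omega]
        exact mul_mem_algPower (by omega) hj (ih i (by omega) hx) hy

theorem algPower_antitone : Antitone (algPower A) := antitone_nat_of_succ_le algPower_succ_le

/-- The plenary powers `x`, `x²`, `(x²)²`, … of an element. -/
def sqIter {A : Type*} [Mul A] (x : A) : ℕ → A
  | 0 => x
  | k + 1 => sqIter x k * sqIter x k

theorem sqIter_mem_algPower (x : A) (k : ℕ) : sqIter x k ∈ algPower A (2 ^ k) := by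
  induction k with
  | zero => rw [pow_zero, algPower_one]; trivial
  | succ k ih =>
    rw [pow_succ, mul_two]
    exact mul_mem_algPower Nat.one_le_two_pow Nat.one_le_two_pow ih ih

theorem map_sqIter {B : Type*} [NonUnitalNonAssocRing B] [Module ℂ B] (f : A →ₙₐ[ℂ] B) (x : A)
    (k : ℕ) : f (sqIter x k) = sqIter (f x) k := by
  induction k with
  | zero => rfl
  | succ k ih => simp only [sqIter, map_mul, ih]

theorem IsNilpotentAlgebra.exists_sqIter_eq_zero (hA : IsNilpotentAlgebra A) :
    ∃ k, ∀ x : A, sqIter x k = 0 := by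
  obtain ⟨k, -, hk⟩ := hA
  refine ⟨k, fun x => ?_⟩
  have h := algPower_antitone (A := A) Nat.lt_two_pow_self.le (sqIter_mem_algPower x k)
  rwa [hk, Submodule.mem_bot] at h

/-- In a product of degree i + j = m one factor has degree at least m/2, and multiplying it lowers
its level by one. Hence the logarithm. -/
theorem map_mem_annSeries_of_mem_algPower {E : Type*} [NonUnitalNonAssocRing E] [Module ℂ E]
    [IsScalarTower ℂ E E] [SMulCommClass ℂ E E] (hc : ∀ x y : E, x * y = y * x)
    (f : A →ₙₐ[ℂ] E) {r : ℕ} (hf : ∀ x, f x ∈ annSeries E r) {m : ℕ} (hm : 1 ≤ m) {x : A}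
    (hx : x ∈ algPower A m) : f x ∈ annSeries E (r - Nat.clog 2 m) := by
  induction m using Nat.strong_induction_on generalizing x with
  | _ m ih =>
    by_cases hm1 : m = 1
    · subst hm1
      simpa using hf x
    obtain ⟨k, rfl⟩ : ∃ k, m = k + 2 := ⟨m - 2, by omega⟩
    have hlog : ∀ i, k + 2 ≤ 2 * i → r - Nat.clog 2 i - 1 ≤ r - Nat.clog 2 (k + 2) := by
      intro i hi
      have h2 : Nat.clog 2 (k + 2) ≤ Nat.clog 2 i + 1 := by
        refine Nat.clog_le_of_le_pow (hi.trans ?_)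
        rw [pow_succ, mul_comm]
        exact Nat.mul_le_mul_right 2 (Nat.le_pow_clog one_lt_two i)
      omega
    refine algPower_le (W := (annSeries E (r - Nat.clog 2 (k + 2))).comap (f : A →ₗ[ℂ] E))
      (fun i j hi hj hij x hx y hy => ?_) hx
    rw [Submodule.mem_comap]
    change f (x * y) ∈ _
    rw [map_mul]
    rcases le_total j i with h | h
    · exact annSeries_mono (hlog i (by omega)) (mul_mem_annSeries (ih i (by omega) hi hx) _)
    · rw [hc]
      exact annSeries_mono (hlog j (by omega)) (mul_mem_annSeries (ih j (by omega) hj hy) _)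

theorem algPower_le_annSeries (hc : ∀ x y : A, x * y = y * x) {r : ℕ} (hr : annSeries A r = ⊤)
    {m : ℕ} (hm : 1 ≤ m) : algPower A m ≤ annSeries A (r - Nat.clog 2 m) := fun _ hx =>
  map_mem_annSeries_of_mem_algPower hc (NonUnitalAlgHom.id ℂ A)
    (fun x => by rw [hr]; trivial) hm hx

theorem isNilpotentAlgebra_of_injective {E : Type*} [NonUnitalNonAssocRing E] [Module ℂ E]
    [IsScalarTower ℂ E E] [SMulCommClass ℂ E E] (hc : ∀ x y : E, x * y = y * x)
    (f : A →ₙₐ[ℂ] E) (hinj : Function.Injective f) {r : ℕ} (hf : ∀ x, f x ∈ annSeries E r) :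
    IsNilpotentAlgebra A := by
  refine ⟨2 ^ r, Nat.one_le_two_pow, (Submodule.eq_bot_iff _).2 fun x hx => hinj ?_⟩
  have h := map_mem_annSeries_of_mem_algPower hc f hf Nat.one_le_two_pow hx
  rw [Nat.clog_pow 2 r one_lt_two, Nat.sub_self, mem_annSeries_zero] at h
  rw [h, map_zero]

/-- The last power of `A` not contained in Z_k has its products with `A` in Z_k, so it lies in
Z_{k+1}. -/
theorem IsNilpotentAlgebra.annSeries_lt_succ (hA : IsNilpotentAlgebra A) {k : ℕ}
    (hk : annSeries A k ≠ ⊤) : annSeries A k < annSeries A (k + 1) := by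
  classical
  have hex : ∃ m, algPower A (m + 1) ≤ annSeries A k := by
    obtain ⟨m, hm, h⟩ := hA
    exact ⟨m - 1, by rw [Nat.sub_add_cancel hm, h]; exact bot_le⟩
  have hspec := Nat.find_spec hex
  have hmin : ∀ m < Nat.find hex, ¬ algPower A (m + 1) ≤ annSeries A k :=
    fun m hm => Nat.find_min hex hm
  generalize Nat.find hex = m at hspec hmin
  cases m with
  | zero => exact absurd (top_le_iff.1 (algPower_one (A := A) ▸ hspec)) hk
  | succ m =>
    refine lt_of_le_not_ge (annSeries_le_succ k) fun hle => hmin m (Nat.lt_succ_self m) ?_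
    exact fun x hx => hle fun y =>
      hspec (mul_mem_algPower (by omega) le_rfl hx (by rw [algPower_one]; trivial))

theorem IsNilpotentAlgebra.finrank_annSeries_add_le [FiniteDimensional ℂ A]
    (hA : IsNilpotentAlgebra A) (a j : ℕ) (h : j ≠ 0 → annSeries A (a + j - 1) ≠ ⊤) :
    finrank ℂ (annSeries A a) + j ≤ finrank ℂ (annSeries A (a + j)) := by
  induction j with
  | zero => simp
  | succ j ih =>
    have h1 : annSeries A (a + j) ≠ ⊤ := h (Nat.succ_ne_zero j)
    have h2 := ih fun hj h3 => h1 (top_le_iff.1 (h3 ▸ annSeries_mono (by omega)))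
    have h3 := Submodule.finrank_lt_finrank_of_lt (hA.annSeries_lt_succ h1)
    rw [← add_assoc a]
    omega

theorem IsNilpotentAlgebra.annSeries_finrank [FiniteDimensional ℂ A]
    (hA : IsNilpotentAlgebra A) : annSeries A (finrank ℂ A) = ⊤ := by
  by_contra h
  have h1 := hA.finrank_annSeries_add_le 0 (finrank ℂ A) fun _ h2 =>
    h (top_le_iff.1 (h2 ▸ annSeries_mono (by omega)))
  rw [zero_add] at h1
  have h2 := Submodule.finrank_lt h
  omega

theorem IsNilpotentAlgebra.algPower_nilpotencyIndex (hA : IsNilpotentAlgebra A) :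
    algPower A (nilpotencyIndex A) = ⊥ := (Nat.sInf_mem hA).2

theorem IsNilpotentAlgebra.lt_nilpotencyIndex (hA : IsNilpotentAlgebra A) {m : ℕ}
    (hm : algPower A m ≠ ⊥) : m < nilpotencyIndex A := by
  by_contra! h
  exact hm (le_bot_iff.1 (hA.algPower_nilpotencyIndex ▸ algPower_antitone h))

theorem IsNilpotentAlgebra.nilpotencyIndex_le [FiniteDimensional ℂ A]
    (hA : IsNilpotentAlgebra A) (hE : IsEvolutionAlgebra A) (hpos : 1 ≤ finrank ℂ A) :
    nilpotencyIndex A ≤ 2 ^ (finrank ℂ A - 1) + 1 := by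
  refine Nat.sInf_le ⟨Nat.le_add_left 1 _, le_bot_iff.1 ?_⟩
  refine (algPower_le_annSeries hE.mul_comm hA.annSeries_finrank (Nat.le_add_left 1 _)).trans ?_
  have h : finrank ℂ A - 1 < Nat.clog 2 (2 ^ (finrank ℂ A - 1) + 1) :=
    (Nat.lt_clog_iff_pow_lt one_lt_two).2 (Nat.lt_succ_self _)
  rw [show finrank ℂ A - Nat.clog 2 (2 ^ (finrank ℂ A - 1) + 1) = 0 by omega]
  exact le_rfl

theorem hasMaximalNilpotencyIndex_of_algPower_ne_bot
    (hE : IsEvolutionAlgebra A) (hA : IsNilpotentAlgebra A) (hpos : 1 ≤ finrank ℂ A)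
    (h : algPower A (2 ^ (finrank ℂ A - 1)) ≠ ⊥) : HasMaximalNilpotencyIndex A := by
  refine ⟨hE, hA, fun F _ _ _ _ _ hFE hF hFA => ?_⟩
  have h1 := hF.nilpotencyIndex_le hFE (hFA ▸ hpos)
  rw [hFA] at h1
  exact h1.trans (hA.lt_nilpotencyIndex h)

end Nilpotency

/-! ### Structure matrices, the extremal chain algebra and maximal index. -/

namespace EvoAlg

variable {ι : Type} [Fintype ι] (M : Matrix ι ι ℂ)

/-- The standard natural basis of `EvoAlg M`. -/
noncomputable def basis : Basis ι ℂ (EvoAlg M) := Basis.ofEquivFun (coordLinearEquiv M)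

theorem basis_repr (x : EvoAlg M) (i : ι) : (basis M).repr x i = x.coord i := rfl

theorem coord_basis [DecidableEq ι] (i : ι) : (basis M i).coord = Pi.single i 1 := by
  ext j
  rw [← basis_repr, Basis.repr_self, Finsupp.single_apply, Pi.single_apply]
  simp only [eq_comm]

theorem isNatural_basis : IsNatural (basis M) := by
  classical
  intro i j hij
  ext k
  rw [coord_mul, coord_zero, Pi.zero_apply]
  refine Finset.sum_eq_zero fun l _ => ?_
  rw [coord_basis, coord_basis, Pi.single_apply, Pi.single_apply]
  by_cases h : l = i
  · rw [if_neg (fun h' => hij (h.symm.trans h')), mul_zero, zero_mul]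
  · rw [if_neg h, zero_mul, zero_mul]

theorem mul_comm (x y : EvoAlg M) : x * y = y * x := (isNatural_basis M).mul_comm x y

theorem isEvolutionAlgebra : IsEvolutionAlgebra (EvoAlg M) := (isNatural_basis M).isEvolutionAlgebra

theorem basis_mul_self (i : ι) : basis M i * basis M i = ∑ k, M i k • basis M k := by
  classical
  apply (basis M).repr.injective
  ext j
  rw [Basis.repr_sum_self, basis_repr, coord_mul, Finset.sum_eq_single i]
  · simp [coord_basis]
  · intro k _ hk
    simp [coord_basis, hk]
  · simp

theorem finrank_eq : finrank ℂ (EvoAlg M) = Fintype.card ι := finrank_eq_card_basis (basis M)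

/-- The structure matrix of the evolution algebra with `e i * e i = e (i + 1)` for `i + 1 < s`. -/
def shiftMatrix (s : ℕ) : Matrix (Fin s) (Fin s) ℂ :=
  fun i k => if (k : ℕ) = i + 1 then 1 else 0

theorem shift_mul_self {s : ℕ} (i : Fin s) (h : (i : ℕ) + 1 < s) :
    basis (shiftMatrix s) i * basis (shiftMatrix s) i = basis (shiftMatrix s) ⟨i + 1, h⟩ := by
  rw [basis_mul_self, Finset.sum_eq_single ⟨i + 1, h⟩]
  · rw [shiftMatrix, if_pos rfl, one_smul]
  · intro k _ hk
    rw [shiftMatrix, if_neg (fun h' => hk (Fin.ext h')), zero_smul]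
  · simp

theorem shift_mul_self_eq_zero {s : ℕ} (i : Fin s) (h : ¬ (i : ℕ) + 1 < s) :
    basis (shiftMatrix s) i * basis (shiftMatrix s) i = 0 := by
  rw [basis_mul_self]
  refine Finset.sum_eq_zero fun k _ => ?_
  rw [shiftMatrix, if_neg (by omega), zero_smul]

theorem shift_mem_annSeries {s k : ℕ} (i : Fin s) (h : s ≤ i + k) :
    basis (shiftMatrix s) i ∈ annSeries (EvoAlg (shiftMatrix s)) k := by
  induction k generalizing i with
  | zero => omega
  | succ k ih =>
    apply (isNatural_basis _).basis_mem_annSeries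
    by_cases hi : (i : ℕ) + 1 < s
    · rw [shift_mul_self i hi]
      exact ih _ (by simp only; omega)
    · rw [shift_mul_self_eq_zero i hi]
      exact Submodule.zero_mem _

theorem shift_isNilpotentAlgebra (s : ℕ) : IsNilpotentAlgebra (EvoAlg (shiftMatrix s)) := by
  refine isNilpotentAlgebra_of_injective (mul_comm _) (NonUnitalAlgHom.id ℂ _)
    (fun _ _ h => h) (r := s) fun x => ?_
  change x ∈ _
  rw [← (basis (shiftMatrix s)).sum_repr x]
  exact Submodule.sum_mem _ fun i _ => Submodule.smul_mem _ _ (shift_mem_annSeries i (by omega))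

theorem sqIter_shift {s : ℕ} (k : ℕ) (hk : k < s) :
    sqIter (basis (shiftMatrix s) ⟨0, by omega⟩) k = basis (shiftMatrix s) ⟨k, hk⟩ := by
  induction k with
  | zero => rfl
  | succ k ih => rw [sqIter, ih (by omega), shift_mul_self ⟨k, by omega⟩ hk]

theorem shift_algPower_ne_bot {s : ℕ} (hs : 1 ≤ s) :
    algPower (EvoAlg (shiftMatrix s)) (2 ^ (s - 1)) ≠ ⊥ := by
  intro h
  have h1 := sqIter_mem_algPower (basis (shiftMatrix s) ⟨0, by omega⟩) (s - 1)
  rw [sqIter_shift (s - 1) (by omega), h, Submodule.mem_bot] at h1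
  exact (basis (shiftMatrix s)).ne_zero _ h1

variable {s : ℕ} {M : Matrix (Fin s) (Fin s) ℂ}

theorem finrank_fin : finrank ℂ (EvoAlg M) = s := by rw [finrank_eq, Fintype.card_fin]

/-- Comparison with the chain algebra, whose last basis vector is the plenary power of the first one
of degree 2^(s-1). -/
theorem algPower_ne_bot (hM : HasMaximalNilpotencyIndex (EvoAlg M)) (hs : 1 ≤ s) :
    algPower (EvoAlg M) (2 ^ (s - 1)) ≠ ⊥ := by
  intro h
  have h1 := hM.2.2 (EvoAlg (shiftMatrix s)) (isEvolutionAlgebra _) (shift_isNilpotentAlgebra s)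
    (by rw [finrank_fin, finrank_fin])
  have h2 := (shift_isNilpotentAlgebra s).lt_nilpotencyIndex (shift_algPower_ne_bot hs)
  have h3 : nilpotencyIndex (EvoAlg M) ≤ 2 ^ (s - 1) := Nat.sInf_le ⟨Nat.one_le_two_pow, h⟩
  omega

/-- The annihilator series needs all s steps to fill dimension s, so the annihilator is a line; it
contains the nonzero power of exponent 2^(s-1) and therefore equals it. -/
theorem annSeries_one_le_algPower_two (hM : HasMaximalNilpotencyIndex (EvoAlg M)) (hs : 2 ≤ s) :
    annSeries (EvoAlg M) 1 ≤ algPower (EvoAlg M) 2 := by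
  have hne := algPower_ne_bot hM (by omega)
  have htop := hM.2.1.annSeries_finrank
  rw [finrank_fin] at htop
  have hclog : Nat.clog 2 (2 ^ (s - 1)) = s - 1 := Nat.clog_pow 2 _ one_lt_two
  have hne' : annSeries (EvoAlg M) (s - 1) ≠ ⊤ := by
    intro h
    have h1 := algPower_le_annSeries (mul_comm M) h (m := 2 ^ (s - 1)) Nat.one_le_two_pow
    rw [hclog, Nat.sub_self] at h1
    exact hne (le_bot_iff.1 h1)
  have h1 := algPower_le_annSeries (mul_comm M) htop (m := 2 ^ (s - 1)) Nat.one_le_two_pow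
  rw [hclog, show s - (s - 1) = 1 by omega] at h1
  have h2 := hM.2.1.finrank_annSeries_add_le 1 (s - 1) fun _ => by
    rwa [show 1 + (s - 1) - 1 = s - 1 by omega]
  rw [show 1 + (s - 1) = s by omega, htop, finrank_top, finrank_fin] at h2
  have h3 : finrank ℂ (algPower (EvoAlg M) (2 ^ (s - 1))) ≠ 0 := by
    rwa [Ne, Submodule.finrank_eq_zero]
  have h4 := Submodule.eq_of_le_of_finrank_le h1 (by omega)
  rw [← h4]
  exact algPower_antitone (le_self_pow₀ one_le_two (by omega))

end EvoAlg

/-! ### Homomorphisms and the recovery of the summands. -/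

section Isomorphisms

theorem IsIsomorphic.symm {A B : Type*} [NonUnitalNonAssocRing A] [Module ℂ A]
    [NonUnitalNonAssocRing B] [Module ℂ B] (h : IsIsomorphic A B) : IsIsomorphic B A := by
  obtain ⟨f, hf⟩ := h
  obtain ⟨g, hl, hr⟩ := Function.bijective_iff_has_inverse.1 hf
  exact ⟨f.inverse g hl hr, Function.bijective_iff_has_inverse.2 ⟨f, hr, hl⟩⟩

theorem IsIsomorphic.trans {A B C : Type*} [NonUnitalNonAssocRing A] [Module ℂ A]
    [NonUnitalNonAssocRing B] [Module ℂ B] [NonUnitalNonAssocRing C] [Module ℂ C]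
    (h : IsIsomorphic A B) (h' : IsIsomorphic B C) : IsIsomorphic A C := by
  obtain ⟨f, hf⟩ := h
  obtain ⟨g, hg⟩ := h'
  exact ⟨g.comp f, hg.comp hf⟩

theorem IsIsomorphic.finrank_eq {A B : Type*} [NonUnitalNonAssocRing A] [Module ℂ A]
    [NonUnitalNonAssocRing B] [Module ℂ B] (h : IsIsomorphic A B) :
    finrank ℂ A = finrank ℂ B := by
  obtain ⟨f, hf⟩ := h
  exact (LinearEquiv.ofBijective (f : A →ₗ[ℂ] B) hf).finrank_eq

theorem isIsomorphic_of_mul_eq_zero {A B : Type*} [NonUnitalNonAssocRing A] [Module ℂ A]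
    [FiniteDimensional ℂ A] [NonUnitalNonAssocRing B] [Module ℂ B] [FiniteDimensional ℂ B]
    (hA : ∀ x y : A, x * y = 0) (hB : ∀ x y : B, x * y = 0) (h : finrank ℂ A = finrank ℂ B) :
    IsIsomorphic A B := by
  let e := LinearEquiv.ofFinrankEq A B h
  exact ⟨{ toFun := e
           map_smul' := e.map_smul
           map_zero' := e.map_zero
           map_add' := e.map_add
           map_mul' := fun x y => by rw [hA, hB, map_zero] }, e.bijective⟩

/-- Two homomorphisms whose images annihilate each other define a homomorphism of the product. -/
theorem exists_coprod {A B E : Type*} [NonUnitalNonAssocRing A] [Module ℂ A]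
    [NonUnitalNonAssocRing B] [Module ℂ B] [NonUnitalNonAssocRing E] [Module ℂ E]
    (f : A →ₙₐ[ℂ] E) (g : B →ₙₐ[ℂ] E) (hf : Function.Injective f) (hg : Function.Injective g)
    (hfg : ∀ a b, f a * g b = 0) (hgf : ∀ a b, g b * f a = 0)
    (hd : Disjoint (LinearMap.range (f : A →ₗ[ℂ] E)) (LinearMap.range (g : B →ₗ[ℂ] E))) :
    ∃ h : A × B →ₙₐ[ℂ] E, Function.Injective h ∧ LinearMap.range (h : A × B →ₗ[ℂ] E) =
      LinearMap.range (f : A →ₗ[ℂ] E) ⊔ LinearMap.range (g : B →ₗ[ℂ] E) := by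
  let φ : A × B →ₗ[ℂ] E := (f : A →ₗ[ℂ] E).coprod (g : B →ₗ[ℂ] E)
  have hφ : ∀ x, φ x = f x.1 + g x.2 := fun x => rfl
  let h : A × B →ₙₐ[ℂ] E :=
    { toFun := φ
      map_smul' := φ.map_smul
      map_zero' := φ.map_zero
      map_add' := φ.map_add
      map_mul' := fun x y => by
        simp only [hφ, Prod.fst_mul, Prod.snd_mul, map_mul, add_mul, mul_add, hfg, hgf, add_zero,
          zero_add] }
  refine ⟨h, ?_, LinearMap.range_coprod _ _⟩
  have hker : LinearMap.ker φ = ⊥ := by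
    rw [LinearMap.ker_coprod_of_disjoint_range _ _ hd, LinearMap.ker_eq_bot.2 hf,
      LinearMap.ker_eq_bot.2 hg, Submodule.prod_bot]
  exact LinearMap.ker_eq_bot.1 hker

namespace EvoAlg

variable {ι : Type} [Fintype ι] {M : Matrix ι ι ℂ} {E : Type*} [NonUnitalNonAssocRing E]
  [Module ℂ E] [IsScalarTower ℂ E E] [SMulCommClass ℂ E E]

/-- A family satisfying the multiplication rules given by `M` defines a homomorphism. -/
theorem exists_hom (w : ι → E) (hw : Pairwise fun i j => w i * w j = 0)
    (hsq : ∀ i, w i * w i = ∑ k, M i k • w k) (hli : LinearIndependent ℂ w) :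
    ∃ f : EvoAlg M →ₙₐ[ℂ] E, Function.Injective f ∧
      LinearMap.range (f : EvoAlg M →ₗ[ℂ] E) = Submodule.span ℂ (Set.range w) := by
  let φ : EvoAlg M →ₗ[ℂ] E := (Fintype.linearCombination ℂ w).comp (coordLinearEquiv M).toLinearMap
  have hφ : ∀ x, φ x = ∑ i, x.coord i • w i := fun x => rfl
  let f : EvoAlg M →ₙₐ[ℂ] E :=
    { toFun := φ
      map_smul' := φ.map_smul
      map_zero' := φ.map_zero
      map_add' := φ.map_add
      map_mul' := fun x y => by
        simp only [hφ, coord_mul, Finset.sum_smul]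
        rw [Finset.sum_mul_sum, Finset.sum_comm]
        refine Finset.sum_congr rfl fun i _ => Eq.symm ?_
        rw [Finset.sum_eq_single i]
        · rw [smul_mul_smul_comm, hsq, Finset.smul_sum]
          simp only [smul_smul]
        · intro j _ hj
          rw [smul_mul_smul_comm, hw hj.symm, smul_zero]
        · simp }
  refine ⟨f, ?_, ?_⟩
  · exact (linearIndependent_iff_injective_fintypeLinearCombination.1 hli).comp (coordLinearEquiv M).injective
  · change LinearMap.range φ = _
    rw [LinearMap.range_comp_of_range_eq_top _ (LinearEquiv.range _), Fintype.range_linearCombination]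

theorem zero_mul_eq (k : ℕ) (x y : ZeroAlg k) : x * y = 0 := by
  ext i
  simp [coord_mul]

theorem idem_ext {x y : IdemAlg} (h : x.coord 0 = y.coord 0) : x = y := by
  ext i
  rw [Subsingleton.elim i 0, h]

theorem idem_coord_mul (x y : IdemAlg) : (x * y).coord 0 = x.coord 0 * y.coord 0 := by
  simp [coord_mul]

theorem idem_eq_zero_of_sqIter {x : IdemAlg} {k : ℕ} (h : sqIter x k = 0) : x = 0 := by
  induction k with
  | zero => exact h
  | succ k ih =>
    refine ih (idem_ext ?_)
    have h1 := congrArg (fun y : IdemAlg => y.coord 0) h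
    simp only [sqIter, idem_coord_mul] at h1
    simpa using h1

theorem map_idem_eq_zero {A : Type*} [NonUnitalNonAssocRing A] [Module ℂ A]
    [IsScalarTower ℂ A A] [SMulCommClass ℂ A A] (hA : IsNilpotentAlgebra A)
    (f : A →ₙₐ[ℂ] IdemAlg) (x : A) : f x = 0 := by
  obtain ⟨k, hk⟩ := hA.exists_sqIter_eq_zero
  refine idem_eq_zero_of_sqIter (k := k) ?_
  rw [← map_sqIter, hk, map_zero]

/-- The nonzero idempotent of `IdemAlg`. -/
def idem : IdemAlg := ⟨1⟩

theorem idem_mul_idem : idem * idem = idem := idem_ext (by simp [idem_coord_mul, idem])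

theorem idem_ne_zero : idem ≠ 0 := fun h => by
  have := congrArg (fun y : IdemAlg => y.coord 0) h
  simp [idem] at this

theorem eq_zero_of_idempotent {s k : ℕ} {M : Matrix (Fin s) (Fin s) ℂ}
    (hM : IsNilpotentAlgebra (EvoAlg M)) {x : EvoAlg M × ZeroAlg k} (hx : x * x = x) : x = 0 := by
  obtain ⟨m, hm⟩ := hM.exists_sqIter_eq_zero
  have h1 : x.1 * x.1 = x.1 := congrArg Prod.fst hx
  have h2 : x.2 * x.2 = x.2 := congrArg Prod.snd hx
  have h3 : ∀ m, sqIter x.1 m = x.1 := fun m => by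
    induction m with
    | zero => rfl
    | succ m ih => rw [sqIter, ih, h1]
  exact Prod.ext ((h3 m).symm.trans (hm _)) (h2.symm.trans (zero_mul_eq k _ _))

theorem not_isIsomorphic_of_idempotent {s k : ℕ} {M : Matrix (Fin s) (Fin s) ℂ}
    (hM : IsNilpotentAlgebra (EvoAlg M)) {A : Type*} [NonUnitalNonAssocRing A] [Module ℂ A]
    {e : A} (he : e * e = e) (he0 : e ≠ 0) : ¬ IsIsomorphic A (EvoAlg M × ZeroAlg k) := by
  rintro ⟨f, hf⟩
  refine he0 (hf.1 ?_)
  rw [map_zero]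
  exact eq_zero_of_idempotent hM (by rw [← map_mul, he])

/-- An element killed by the projection is in the annihilator, hence in A²; the component in the
zero algebra vanishes on A². -/
theorem injective_fst_comp {s : ℕ} {M : Matrix (Fin s) (Fin s) ℂ}
    (hM : HasMaximalNilpotencyIndex (EvoAlg M)) (hs : 2 ≤ s) {B : Type*}
    [NonUnitalNonAssocRing B] [Module ℂ B] {k : ℕ} (h : EvoAlg M →ₙₐ[ℂ] B × ZeroAlg k)
    (hh : Function.Injective h) :
    Function.Injective ((NonUnitalAlgHom.fst ℂ B (ZeroAlg k)).comp h) := by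
  rw [injective_iff_map_eq_zero]
  intro x hx
  have hx1 : (h x).1 = 0 := hx
  have hann : x ∈ annSeries (EvoAlg M) 1 := by
    intro y
    rw [mem_annSeries_zero]
    apply hh
    rw [map_mul, map_zero]
    exact Prod.ext (by rw [Prod.fst_mul, hx1, zero_mul]; rfl) (zero_mul_eq k _ _)
  have h2 : algPower (EvoAlg M) 2 ≤ LinearMap.ker
      (((NonUnitalAlgHom.snd ℂ B (ZeroAlg k)).comp h : EvoAlg M →ₙₐ[ℂ] ZeroAlg k) :
        EvoAlg M →ₗ[ℂ] ZeroAlg k) := by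
    refine algPower_le (k := 0) fun _ _ _ _ _ a _ b _ => ?_
    rw [LinearMap.mem_ker]
    change (h (a * b)).2 = 0
    rw [map_mul]
    exact zero_mul_eq k _ _
  have hx2 : (h x).2 = 0 := h2 (annSeries_one_le_algPower_two hM hs hann)
  apply hh
  rw [map_zero]
  exact Prod.ext hx1 hx2

theorem mul_eq_zero_of_dim_one {M : Matrix (Fin 1) (Fin 1) ℂ}
    (hM : IsNilpotentAlgebra (EvoAlg M)) (x y : EvoAlg M) : x * y = 0 := by
  have h := hM.annSeries_finrank
  rw [finrank_fin] at h
  have hx : x ∈ annSeries (EvoAlg M) 1 := h ▸ Submodule.mem_top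
  exact mem_annSeries_zero.1 (hx y)

theorem le_of_injective {s s' k : ℕ} {M : Matrix (Fin s) (Fin s) ℂ}
    {M' : Matrix (Fin s') (Fin s') ℂ} (hM : HasMaximalNilpotencyIndex (EvoAlg M))
    (hs' : 1 ≤ s') (h : EvoAlg M →ₙₐ[ℂ] EvoAlg M' × ZeroAlg k) (hh : Function.Injective h) :
    s ≤ s' := by
  by_cases hs : 2 ≤ s
  · have h1 := LinearMap.finrank_le_finrank_of_injective
      (f := (((NonUnitalAlgHom.fst ℂ (EvoAlg M') (ZeroAlg k)).comp h :
        EvoAlg M →ₙₐ[ℂ] EvoAlg M') : EvoAlg M →ₗ[ℂ] EvoAlg M')) (injective_fst_comp hM hs h hh)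
    rwa [finrank_fin, finrank_fin] at h1
  · omega

theorem eq_and_isIsomorphic {s s' k k' : ℕ} {M : Matrix (Fin s) (Fin s) ℂ}
    {M' : Matrix (Fin s') (Fin s') ℂ} (hM : HasMaximalNilpotencyIndex (EvoAlg M))
    (hM' : HasMaximalNilpotencyIndex (EvoAlg M')) (hs : 1 ≤ s) (hs' : 1 ≤ s')
    (h : EvoAlg M →ₙₐ[ℂ] EvoAlg M' × ZeroAlg k') (hh : Function.Injective h)
    (h' : EvoAlg M' →ₙₐ[ℂ] EvoAlg M × ZeroAlg k) (hh' : Function.Injective h') :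
    s = s' ∧ IsIsomorphic (EvoAlg M) (EvoAlg M') := by
  obtain rfl : s = s' := le_antisymm (le_of_injective hM hs' h hh) (le_of_injective hM' hs h' hh')
  refine ⟨rfl, ?_⟩
  by_cases hs2 : 2 ≤ s
  · have hinj := injective_fst_comp hM hs2 h hh
    refine ⟨_, hinj, ?_⟩
    exact (LinearMap.injective_iff_surjective_of_finrank_eq_finrank
      (f := (((NonUnitalAlgHom.fst ℂ (EvoAlg M') (ZeroAlg k')).comp h :
        EvoAlg M →ₙₐ[ℂ] EvoAlg M') : EvoAlg M →ₗ[ℂ] EvoAlg M'))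
        (by rw [finrank_fin, finrank_fin])).1 hinj
  · obtain rfl : s = 1 := by omega
    exact isIsomorphic_of_mul_eq_zero (mul_eq_zero_of_dim_one hM.2.1)
      (mul_eq_zero_of_dim_one hM'.2.1) (by rw [finrank_fin, finrank_fin])

theorem exists_injective_of_prod {s k : ℕ} {M : Matrix (Fin s) (Fin s) ℂ} {B : Type*}
    [NonUnitalNonAssocRing B] [Module ℂ B] (h : IsIsomorphic (EvoAlg M × ZeroAlg k) B) :
    ∃ f : EvoAlg M →ₙₐ[ℂ] B, Function.Injective f := by
  obtain ⟨f, hf⟩ := h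
  exact ⟨f.comp (NonUnitalAlgHom.inl ℂ _ _), hf.1.comp fun x y hxy => congrArg Prod.fst hxy⟩

/-- A nilpotent algebra has only the zero homomorphism to `IdemAlg`, so the embedding lives in the
factor `B`. -/
theorem exists_injective_of_idem_prod {s k : ℕ} {M : Matrix (Fin s) (Fin s) ℂ} {B : Type*}
    [NonUnitalNonAssocRing B] [Module ℂ B] (hM : IsNilpotentAlgebra (EvoAlg M))
    (h : IsIsomorphic (IdemAlg × EvoAlg M × ZeroAlg k) (IdemAlg × B)) :
    ∃ f : EvoAlg M →ₙₐ[ℂ] B, Function.Injective f := by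
  obtain ⟨f, hf⟩ := h
  let g : EvoAlg M →ₙₐ[ℂ] IdemAlg × B :=
    f.comp ((NonUnitalAlgHom.inr ℂ _ _).comp (NonUnitalAlgHom.inl ℂ _ _))
  have hg : Function.Injective g :=
    hf.1.comp fun x y hxy => congrArg (fun z : IdemAlg × EvoAlg M × ZeroAlg k => z.2.1) hxy
  refine ⟨(NonUnitalAlgHom.snd ℂ _ _).comp g, ?_⟩
  rw [injective_iff_map_eq_zero]
  intro x hx
  apply hg
  rw [map_zero]
  exact Prod.ext (map_idem_eq_zero hM ((NonUnitalAlgHom.fst ℂ _ _).comp g) x) hx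

theorem exists_mul_ne_zero {s : ℕ} {M : Matrix (Fin s) (Fin s) ℂ}
    (hM : HasMaximalNilpotencyIndex (EvoAlg M)) (hs : 2 ≤ s) : ∃ x y : EvoAlg M, x * y ≠ 0 := by
  by_contra! h
  refine algPower_ne_bot hM (by omega) (le_bot_iff.1 ?_)
  refine (algPower_antitone (le_self_pow₀ one_le_two (by omega : s - 1 ≠ 0))).trans ?_
  refine algPower_le (k := 0) fun _ _ _ _ _ x _ y _ => ?_
  rw [h, Submodule.mem_bot]

end EvoAlg

end Isomorphisms

/-! ### Decomposition of the nilpotent part. -/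

section NilpotentPart

variable {E : Type*} [NonUnitalNonAssocRing E] [Module ℂ E] [IsScalarTower ℂ E E]
  [SMulCommClass ℂ E E]

theorem mul_eq_zero_of_mem_annSeries_one {x : E} (hx : x ∈ annSeries E 1) (y : E) : x * y = 0 :=
  mem_annSeries_zero.1 (hx y)

theorem exists_zeroAlg_hom [FiniteDimensional ℂ E] {C : Submodule ℂ E}
    (hC : C ≤ annSeries E 1) : ∃ g : ZeroAlg (finrank ℂ C) →ₙₐ[ℂ] E, Function.Injective g ∧
      LinearMap.range (g : ZeroAlg (finrank ℂ C) →ₗ[ℂ] E) = C := by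
  let b := finBasis ℂ C
  have h0 : ∀ i (y : E), (b i : E) * y = 0 := fun i y =>
    mul_eq_zero_of_mem_annSeries_one (hC (b i).2) y
  obtain ⟨g, hg, hr⟩ := EvoAlg.exists_hom (M := 0) (fun i => (b i : E)) (fun i j _ => h0 i _)
    (fun i => by simp [h0]) (b.linearIndependent.map' C.subtype C.ker_subtype)
  refine ⟨g, hg, hr.trans ?_⟩
  have h1 := Submodule.map_span C.subtype (Set.range b)
  rw [b.span_eq, Submodule.map_top, Submodule.range_subtype, ← Set.range_comp] at h1
  exact h1.symm

/-- By absorption x² ∈ Z_k forces x ∈ Z_{k+1}: squaring descends at most one level. This bounds the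
index from below. -/
theorem IsAbsorbing.sqIter_notMem_annSeries (hE : IsAbsorbing E) (hc : ∀ x y : E, x * y = y * x)
    {x : E} (m k : ℕ) (hx : x ∉ annSeries E (k + m)) : sqIter x m ∉ annSeries E k := by
  induction m generalizing k with
  | zero => exact hx
  | succ m ih =>
    have h1 := ih (k + 1) (by rwa [add_right_comm])
    exact fun h => h1 fun y =>
      hE.mul_mem_of_sq_mem hc (fun x hx => mul_mem_annSeries' hx) h y

variable {ι : Type*} [Fintype ι] {v : Basis ι ℂ E}

theorem IsNatural.exists_mem_annSeries (hv : IsNatural v) {k : ℕ}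
    (hk : annSeries E k ≠ annSeries E (k + 1)) :
    ∃ i, v i ∈ annSeries E (k + 1) ∧ v i ∉ annSeries E k := by
  by_contra! h
  refine hk (le_antisymm (annSeries_le_succ k) fun x hx => ?_)
  rw [← v.sum_repr x]
  refine Submodule.sum_mem _ fun i _ => ?_
  by_cases hi : v.repr x i = 0
  · rw [hi, zero_smul]
    exact Submodule.zero_mem _
  · exact Submodule.smul_mem _ _ (h i (hv.mem_annSeries_of_repr_ne_zero hx hi))

open Classical in
theorem IsNatural.card_annSeries_le (hv : IsNatural v) (hE : IsAbsorbing E) (k : ℕ) :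
    Fintype.card {i // v i ∈ annSeries E (k + 1) ∧ v i ∉ annSeries E 1} ≤ k := by
  rw [Fintype.card_subtype]
  induction k with
  | zero => simp
  | succ k ih =>
    by_cases h : ∃ i, v i ∈ annSeries E (k + 2) ∧ v i ∉ annSeries E (k + 1)
    · obtain ⟨j, hj, hj'⟩ := h
      refine (Finset.card_le_card (t := insert j (Finset.univ.filter fun i =>
        v i ∈ annSeries E (k + 1) ∧ v i ∉ annSeries E 1)) fun i hi => ?_).trans
        ((Finset.card_insert_le _ _).trans (Nat.succ_le_succ ih))
      simp only [Finset.mem_filter, Finset.mem_univ, true_and, Finset.mem_insert] at hi ⊢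
      by_cases hik : v i ∈ annSeries E (k + 1)
      · exact Or.inr ⟨hik, hi.2⟩
      · exact Or.inl (hv.eq_of_mem_annSeries hE hi.1 hik hj hj')
    · push Not at h
      refine (Finset.card_le_card fun i hi => ?_).trans (ih.trans (Nat.le_succ k))
      simp only [Finset.mem_filter, Finset.mem_univ, true_and] at hi ⊢
      exact ⟨h i hi.1, hi.2⟩

/-- All squares meet the annihilator in a single line ℂg₀. A complement C of that line in the
annihilator becomes the zero summand, and a complement of C containing all squares cuts out the
summand of maximal index. -/
theorem IsNatural.exists_hom_annSeries [FiniteDimensional ℂ E] (hv : IsNatural v)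
    (hE : IsAbsorbing E) {r : ℕ} (hr : 2 ≤ r) (hlt : ∀ k < r, annSeries E k ≠ annSeries E (k + 1)) :
    ∃ (s : ℕ) (M : Matrix (Fin s) (Fin s) ℂ) (d : ℕ), 2 ≤ s ∧
      HasMaximalNilpotencyIndex (EvoAlg M) ∧
      ∃ g : EvoAlg M × ZeroAlg d →ₙₐ[ℂ] E, Function.Injective g ∧
        LinearMap.range (g : EvoAlg M × ZeroAlg d →ₗ[ℂ] E) = annSeries E r := by
  classical
  have hc := hv.mul_comm
  have h1r : annSeries E 1 ≤ annSeries E r := annSeries_mono (by omega)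
  have hZl : ∀ {z : E}, z ∈ annSeries E 1 → ∀ y, z * y = 0 := mul_eq_zero_of_mem_annSeries_one
  have hZr : ∀ {z : E}, z ∈ annSeries E 1 → ∀ y, y * z = 0 := fun hz y => by rw [hc, hZl hz]
  obtain ⟨i₀, hi₀, hi₀'⟩ := hv.exists_mem_annSeries (hlt 1 (by omega))
  set g₀ := v i₀ * v i₀ with hg₀
  have hg₀mem : g₀ ∈ annSeries E 1 := hi₀ (v i₀)
  have hg₀ne : g₀ ≠ 0 := fun h => hi₀' (hv.basis_mem_annSeries (by rw [← hg₀, h]; exact zero_mem _))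
  set E2 : Submodule ℂ E := Submodule.span ℂ (Set.range fun i => v i * v i) with hE2
  have hsqE2 : ∀ i, v i * v i ∈ E2 := fun i => Submodule.subset_span ⟨i, rfl⟩
  have hE2Z : ∀ x ∈ E2, x ∈ annSeries E 1 → x ∈ Submodule.span ℂ {g₀} := by
    intro x hx hxZ
    obtain ⟨c, rfl⟩ := (Submodule.mem_span_range_iff_exists_fun ℂ).1 hx
    refine Submodule.sum_mem _ fun i _ => ?_
    have h1 := hv.smul_sq_mem_of_sum_mem hE (fun x hx => mul_mem_annSeries' hx) hxZ i
    by_cases hci : c i = 0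
    · rw [hci, zero_smul]; exact zero_mem _
    · have h2 := hv.basis_mem_annSeries (((annSeries E 1).smul_mem_iff hci).1 h1)
      by_cases hi1 : v i ∈ annSeries E 1
      · rw [hZl hi1, smul_zero]; exact zero_mem _
      · rw [hv.eq_of_mem_annSeries hE h2 hi1 hi₀ hi₀']
        exact Submodule.smul_mem _ _ (Submodule.mem_span_singleton_self _)
  obtain ⟨C₀, hC₀⟩ := Submodule.exists_isCompl (Submodule.span ℂ {g₀})
  set C := C₀ ⊓ annSeries E 1 with hCdef
  have hCZ : C ≤ annSeries E 1 := inf_le_right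
  have hCsup : Submodule.span ℂ {g₀} ⊔ C = annSeries E 1 := by
    rw [hCdef, ← sup_inf_assoc_of_le _ ((Submodule.span_singleton_le_iff_mem _ _).2 hg₀mem),
      hC₀.sup_eq_top, top_inf_eq]
  have hdis : Disjoint E2 C := by
    rw [Submodule.disjoint_def]
    exact fun x hx hxC =>
      Submodule.disjoint_def.1 hC₀.disjoint x (hE2Z x hx (hCZ hxC)) hxC.1
  obtain ⟨q, hq2, hq⟩ := hdis.exists_isCompl
  have hqC : ∀ x ∈ q, x ∈ C → x = 0 := Submodule.disjoint_def.1 hq.disjoint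
  have hdec : ∀ x : E, ∃ a ∈ q, x - a ∈ C := by
    intro x
    obtain ⟨a, ha, b, hb, hab⟩ := Submodule.mem_sup.1 (hq.sup_eq_top ▸ Submodule.mem_top (x := x))
    exact ⟨a, ha, by rwa [← hab, add_sub_cancel_left]⟩
  -- π x is the component of x in `q` along C. As C annihilates everything, passing from x to π x
  -- changes no product.
  choose π hπq hπC using hdec
  have hπmul : ∀ x y, π x * π y = x * y := by
    intro x y
    have hx : x * y = (π x + (x - π x)) * (π y + (y - π y)) := by
      rw [add_sub_cancel, add_sub_cancel]
    rw [hx, mul_add, hZr (hCZ (hπC y)), add_zero, add_mul, hZl (hCZ (hπC x)), add_zero]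
  have hπN : ∀ k, 1 ≤ k → ∀ x, π x ∈ annSeries E k ↔ x ∈ annSeries E k := by
    intro k hk x
    rw [← Submodule.add_mem_iff_left (annSeries E k) (annSeries_mono hk (hCZ (hπC x))),
      add_sub_cancel]
  let p : ι → Prop := fun i => v i ∈ annSeries E r ∧ v i ∉ annSeries E 1
  -- One vector for the annihilator and one for each basis vector in a higher layer.
  let w : Option {i // p i} → E := fun o => o.elim g₀ fun i => π (v i)
  have hw : Pairwise fun i j => w i * w j = 0 := by
    rintro (_ | i) (_ | j) hij
    · exact absurd rfl hij
    · exact hZl hg₀mem _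
    · exact hZr hg₀mem _
    · change π (v i) * π (v j) = 0
      rw [hπmul]
      exact hv fun h => hij (congrArg some (Subtype.ext h))
  have hwspan : Submodule.span ℂ (Set.range w) = q ⊓ annSeries E r := by
    apply le_antisymm
    · rw [Submodule.span_le]
      rintro _ ⟨_ | i, rfl⟩
      · exact ⟨hq2 (hsqE2 i₀), h1r hg₀mem⟩
      · exact ⟨hπq _, (hπN r (by omega) _).2 i.2.1⟩
    · rintro x ⟨hxq, hxr⟩
      set S := Submodule.span ℂ (Set.range w) with hS
      have hSw : ∀ o, w o ∈ S := fun o => Submodule.subset_span ⟨o, rfl⟩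
      set y : E := ∑ i, if p i then v.repr x i • π (v i) else 0 with hy
      have hyS : y ∈ S := by
        refine Submodule.sum_mem _ fun i _ => ?_
        split_ifs with hi
        · exact Submodule.smul_mem _ _ (hSw (some ⟨i, hi⟩))
        · exact zero_mem _
      have hyq : y ∈ q := by
        refine Submodule.sum_mem _ fun i _ => ?_
        split_ifs with hi
        · exact Submodule.smul_mem _ _ (hπq _)
        · exact zero_mem _
      have hxy : x - y ∈ annSeries E 1 := by
        have : x - y = ∑ i, (v.repr x i • v i - if p i then v.repr x i • π (v i) else 0) := by
          rw [Finset.sum_sub_distrib, v.sum_repr]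
        rw [this]
        refine Submodule.sum_mem _ fun i _ => ?_
        split_ifs with hi
        · rw [← smul_sub]
          exact Submodule.smul_mem _ _ (hCZ (hπC _))
        · rw [sub_zero]
          by_cases hxi : v.repr x i = 0
          · rw [hxi, zero_smul]; exact zero_mem _
          · refine Submodule.smul_mem _ _ ?_
            by_contra h1
            exact hi ⟨hv.mem_annSeries_of_repr_ne_zero hxr hxi, h1⟩
      rw [← hCsup] at hxy
      obtain ⟨a, ha, b, hb, hab⟩ := Submodule.mem_sup.1 hxy
      obtain ⟨c, rfl⟩ := Submodule.mem_span_singleton.1 ha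
      have hg₀q : g₀ ∈ q := hq2 (hsqE2 i₀)
      have hb0 : b = 0 := by
        refine hqC b ?_ hb
        rw [eq_sub_of_add_eq' hab]
        exact q.sub_mem (q.sub_mem hxq hyq) (q.smul_mem _ hg₀q)
      rw [hb0, add_zero] at hab
      rw [← sub_add_cancel x y, ← hab]
      exact S.add_mem (S.smul_mem _ (hSw none)) hyS
  have hwli : LinearIndependent ℂ w := by
    rw [Fintype.linearIndependent_iff]
    intro c hsum
    rw [Fintype.sum_option] at hsum
    change c none • g₀ + ∑ i : {i // p i}, c (some i) • π (v i) = 0 at hsum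
    have hmem : ∑ i : {i // p i}, c (some i) • v i ∈ annSeries E 1 := by
      have : ∑ i : {i // p i}, c (some i) • v i =
          ∑ i : {i // p i}, c (some i) • (v i - π (v i)) - c none • g₀ := by
        simp only [smul_sub, Finset.sum_sub_distrib]
        rw [sub_sub, add_comm (∑ i : {i // p i}, c (some i) • π (v i)), hsum, sub_zero]
      rw [this]
      exact Submodule.sub_mem _ (Submodule.sum_mem _ fun i _ =>
        Submodule.smul_mem _ _ (hCZ (hπC _))) (Submodule.smul_mem _ _ hg₀mem)
    have hsome : ∀ j : {i // p i}, c (some j) = 0 := by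
      intro j
      by_contra hj
      refine j.2.2 (hv.mem_annSeries_of_repr_ne_zero hmem ?_)
      rw [map_sum, Finsupp.finsetSum_apply, Finset.sum_eq_single j]
      · simpa using hj
      · intro i _ hij
        rw [map_smul, v.repr_self, Finsupp.smul_apply,
          Finsupp.single_eq_of_ne (fun h => hij (Subtype.ext h.symm)), smul_zero]
      · simp
    simp only [hsome, zero_smul, Finset.sum_const_zero, add_zero] at hsum
    rintro (_ | i)
    · exact (smul_eq_zero.1 hsum).resolve_right hg₀ne
    · exact hsome i
  have hwsq : ∀ o, w o * w o ∈ Submodule.span ℂ (Set.range w) := by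
    rw [hwspan]
    rintro (_ | i)
    · exact (hZl hg₀mem g₀).symm ▸ zero_mem (q ⊓ annSeries E r)
    · change π (v i) * π (v i) ∈ _
      rw [hπmul]
      exact ⟨hq2 (hsqE2 i), mul_mem_annSeries' i.2.1 _⟩
  set s := Fintype.card (Option {i // p i}) with hs
  have hsp : s = Fintype.card {i // p i} + 1 := Fintype.card_option
  have hs2 : 2 ≤ s := by
    have : 0 < Fintype.card {i // p i} :=
      Fintype.card_pos_iff.2 ⟨⟨i₀, annSeries_mono hr hi₀, hi₀'⟩⟩
    omega
  have hsr : s ≤ r := by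
    obtain ⟨r, rfl⟩ : ∃ k, r = k + 1 := ⟨r - 1, by omega⟩
    have := hv.card_annSeries_le hE r
    rw [hsp]
    refine Nat.succ_le_succ (le_trans (le_of_eq ?_) this)
    exact Fintype.card_congr (Equiv.refl _)
  let eq := (Fintype.equivFin (Option {i // p i})).symm
  have hrange : Set.range (w ∘ eq) = Set.range w := eq.surjective.range_comp w
  have hex : ∀ i, ∃ c : Fin s → ℂ, ∑ k, c k • (w ∘ eq) k = (w ∘ eq) i * (w ∘ eq) i := fun i => by
    rw [← Submodule.mem_span_range_iff_exists_fun, hrange]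
    exact hwsq (eq i)
  obtain ⟨M, hM⟩ : ∃ M : Matrix (Fin s) (Fin s) ℂ,
      ∀ i, ∑ k, M i k • (w ∘ eq) k = (w ∘ eq) i * (w ∘ eq) i := Classical.axiom_of_choice hex
  obtain ⟨f, hf, hfr⟩ := EvoAlg.exists_hom (M := M) (w ∘ eq)
    (fun i j hij => hw (eq.injective.ne hij)) (fun i => (hM i).symm) (hwli.comp eq eq.injective)
  rw [hrange, hwspan] at hfr
  have hfmem : ∀ x, f x ∈ q ⊓ annSeries E r := fun x => hfr ▸ ⟨x, rfl⟩
  obtain ⟨g, hg, hgr⟩ := exists_zeroAlg_hom hCZ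
  have hgmem : ∀ x, g x ∈ C := fun x => by
    have : g x ∈ LinearMap.range (g : ZeroAlg (finrank ℂ C) →ₗ[ℂ] E) := ⟨x, rfl⟩
    rwa [hgr] at this
  obtain ⟨h, hh, hhr⟩ := exists_coprod f g hf hg (fun a b => hZr (hCZ (hgmem b)) _)
    (fun a b => hZl (hCZ (hgmem b)) _) (by
      rw [hfr, hgr]
      exact hq.disjoint.mono_left inf_le_left)
  refine ⟨s, M, finrank ℂ C, hs2, ?_, h, hh, ?_⟩
  · refine hasMaximalNilpotencyIndex_of_algPower_ne_bot (EvoAlg.isEvolutionAlgebra M)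
      (isNilpotentAlgebra_of_injective hc f hf fun x => (hfmem x).2)
      (by rw [EvoAlg.finrank_fin]; omega) ?_
    rw [EvoAlg.finrank_fin]
    -- A vector of the top layer has nonzero plenary power of degree 2^(r-1); since s ≤ r, this
    -- shows that the power of exponent 2^(s-1) is nonzero.
    obtain ⟨i, hi, hi'⟩ := hv.exists_mem_annSeries (hlt (r - 1) (by omega))
    rw [Nat.sub_add_cancel (by omega)] at hi
    have hu : π (v i) ∈ LinearMap.range (f : EvoAlg M →ₗ[ℂ] E) := by
      rw [hfr]
      exact ⟨hπq _, (hπN r (by omega) _).2 hi⟩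
    obtain ⟨x, hx⟩ := hu
    have hx' : f x = π (v i) := hx
    have hnot : f x ∉ annSeries E (0 + (r - 1)) := by
      rw [zero_add, hx', hπN (r - 1) (by omega)]
      exact hi'
    have h3 := hE.sqIter_notMem_annSeries hc (r - 1) 0 hnot
    intro hbot
    have h4 := algPower_antitone (A := EvoAlg M)
      (Nat.pow_le_pow_right two_pos (by omega : s - 1 ≤ r - 1)) (sqIter_mem_algPower x (r - 1))
    rw [hbot, Submodule.mem_bot] at h4
    rw [← map_sqIter, h4, map_zero] at h3
    exact h3 (zero_mem _)
  · rw [hhr, hfr, hgr, sup_comm, ← sup_inf_assoc_of_le _ (hCZ.trans h1r), sup_comm C q,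
      hq.sup_eq_top, top_inf_eq]

end NilpotentPart

/-! ### Splitting off an idempotent and the four types. -/

section Classification

variable {E : Type*} [NonUnitalNonAssocRing E] [Module ℂ E] [IsScalarTower ℂ E E]
  [SMulCommClass ℂ E E]

theorem isIsomorphic_of_range_eq_top {A : Type*} [NonUnitalNonAssocRing A] [Module ℂ A]
    {g : A →ₙₐ[ℂ] E} (hg : Function.Injective g)
    (hr : LinearMap.range (g : A →ₗ[ℂ] E) = ⊤) : IsIsomorphic E A :=
  IsIsomorphic.symm ⟨g, hg, LinearMap.range_eq_top.1 hr⟩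

variable (E) in
theorem exists_annSeries_stable [FiniteDimensional ℂ E] :
    ∃ r, annSeries E r = annSeries E (r + 1) ∧
      ∀ k < r, annSeries E k ≠ annSeries E (k + 1) := by
  classical
  have hex : ∃ r, annSeries E r = annSeries E (r + 1) := by
    obtain ⟨r, hr⟩ := monotone_stabilizes_iff_noetherian.2 (inferInstance : IsNoetherian ℂ E)
      ⟨annSeries E, annSeries_mono⟩
    exact ⟨r, hr (r + 1) (Nat.le_succ r)⟩
  exact ⟨Nat.find hex, Nat.find_spec hex, fun k hk => Nat.find_min hex hk⟩

/-- If the annihilator series does not exhaust the algebra, then an idempotent splits off. -/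
theorem IsNatural.exists_idempotent_isCompl {ι : Type*} [Fintype ι] {v : Basis ι ℂ E}
    (hv : IsNatural v) (hE : IsAbsorbing E) {r : ℕ} (hr : annSeries E r = annSeries E (r + 1))
    (htop : annSeries E r ≠ ⊤) :
    ∃ e : E, e * e = e ∧ e ≠ 0 ∧ (∀ z ∈ annSeries E r, e * z = 0) ∧
      IsCompl (Submodule.span ℂ {e}) (annSeries E r) := by
  have hJ : ∀ x ∈ annSeries E r, ∀ y, x * y ∈ annSeries E r := fun x hx => mul_mem_annSeries' hx
  have hJ' : ∀ x, (∀ y, x * y ∈ annSeries E r) → x ∈ annSeries E r := fun x hx => hr ▸ hx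
  have hsum : ∀ x, (∀ i, v i ∉ annSeries E r → v.repr x i = 0) → x ∈ annSeries E r := by
    intro x hx
    rw [← v.sum_repr x]
    refine Submodule.sum_mem _ fun i _ => ?_
    by_cases hi : v i ∈ annSeries E r
    · exact Submodule.smul_mem _ _ hi
    · rw [hx i hi, zero_smul]
      exact zero_mem _
  obtain ⟨i, hi⟩ : ∃ i, v i ∉ annSeries E r := by
    by_contra! h
    exact htop (Submodule.eq_top_iff'.2 fun x => hsum x fun i hi => absurd (h i) hi)
  obtain ⟨x, -, ⟨j, hj, hxj⟩, hx⟩ := hv.exists_idempotent_mod_of_notMem hE hJ hJ' hi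
  obtain ⟨e, he, hee⟩ := exists_idempotent_of_mod_annSeries le_rfl hv.mul_comm
    (fun h => hj (hv.mem_annSeries_of_repr_ne_zero h hxj)) hx
  have hei : v.repr e i ≠ 0 := by
    intro h
    refine he (hsum e fun k hk => ?_)
    rw [hv.eq_of_notMem hE hJ hJ' hk hi, h]
  have hdis : ∀ c : ℂ, c • e ∈ annSeries E r → c = 0 := by
    intro c hc
    by_contra h
    exact he ((Submodule.smul_mem_iff _ h).1 hc)
  refine ⟨e, hee, fun h => he (h ▸ zero_mem _), fun z hz => ?_, ?_, ?_⟩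
  -- Absorption for the line ℂe puts ez in ℂe, and ez also lies in Z_r, which meets that line in 0.
  · have h := hE.mul_mem_sup_span_of_idempotent (J := ⊥) hv.mul_comm
      (fun x hx y => by rw [(Submodule.mem_bot ℂ).1 hx, zero_mul]; exact zero_mem _)
      (x := e) (by rw [hee, sub_self]; exact zero_mem _) z
    rw [bot_sup_eq] at h
    obtain ⟨c, hc⟩ := Submodule.mem_span_singleton.1 h
    have h2 : e * z ∈ annSeries E r := by rw [hv.mul_comm]; exact hJ z hz e
    rw [← hc] at h2 ⊢
    rw [hdis c h2, zero_smul]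
  · rw [Submodule.disjoint_def]
    intro x hx hxr
    obtain ⟨c, rfl⟩ := Submodule.mem_span_singleton.1 hx
    rw [hdis c hxr, zero_smul]
  · rw [codisjoint_iff, Submodule.eq_top_iff']
    intro x
    rw [← add_sub_cancel ((v.repr x i / v.repr e i) • e) x]
    refine Submodule.add_mem_sup
      (Submodule.smul_mem _ _ (Submodule.mem_span_singleton_self e)) (hsum _ fun k hk => ?_)
    rw [hv.eq_of_notMem hE hJ hJ' hk hi, map_sub, map_smul, Finsupp.sub_apply, Finsupp.smul_apply,
      smul_eq_mul, div_mul_cancel₀ _ hei, sub_self]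

/-- Splitting off an idempotent. -/
theorem isIsomorphic_idemAlg_prod (hc : ∀ x y : E, x * y = y * x) {e : E} (hee : e * e = e)
    (he : e ≠ 0) {N : Submodule ℂ E} (heN : ∀ z ∈ N, e * z = 0)
    (hcompl : IsCompl (Submodule.span ℂ {e}) N) {A : Type*} [NonUnitalNonAssocRing A] [Module ℂ A]
    {g : A →ₙₐ[ℂ] E} (hg : Function.Injective g) (hr : LinearMap.range (g : A →ₗ[ℂ] E) = N) :
    IsIsomorphic E (IdemAlg × A) := by
  obtain ⟨f, hf, hfr⟩ := EvoAlg.exists_hom (M := (1 : Matrix (Fin 1) (Fin 1) ℂ))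
    (fun _ : Fin 1 => e) (fun i j hij => absurd (Subsingleton.elim i j) hij)
    (fun i => by obtain rfl := Subsingleton.elim i 0; simp [hee])
    (LinearIndependent.of_subsingleton 0 he)
  rw [Set.range_const] at hfr
  have hgN : ∀ b, g b ∈ N := fun b => hr ▸ ⟨b, rfl⟩
  have hfg : ∀ a b, f a * g b = 0 := by
    intro a b
    have ha : f a ∈ Submodule.span ℂ {e} := hfr ▸ ⟨a, rfl⟩
    obtain ⟨c, hc⟩ := Submodule.mem_span_singleton.1 ha
    rw [← hc, smul_mul_assoc, heN _ (hgN b), smul_zero]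
  obtain ⟨h, hh, hhr⟩ := exists_coprod f g hf hg hfg (fun a b => by rw [hc, hfg])
    (by rw [hfr, hr]; exact hcompl.disjoint)
  refine isIsomorphic_of_range_eq_top hh ?_
  rw [hhr, hfr, hr, hcompl.sup_eq_top]

theorem hasMaximalNilpotencyIndex_zeroAlg_one : HasMaximalNilpotencyIndex (ZeroAlg 1) := by
  have h1 : finrank ℂ (ZeroAlg 1) = 1 := EvoAlg.finrank_fin
  refine hasMaximalNilpotencyIndex_of_algPower_ne_bot (EvoAlg.isEvolutionAlgebra _)
    ⟨2, one_le_two, le_bot_iff.1 (algPower_le (k := 0) fun _ _ _ _ _ x _ y _ => ?_)⟩ h1.ge ?_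
  · rw [EvoAlg.zero_mul_eq, Submodule.mem_bot]
  · have : Nontrivial (ZeroAlg 1) := Module.nontrivial_of_finrank_pos (R := ℂ) (by omega)
    rw [h1, Nat.sub_self, pow_zero, algPower_one]
    exact top_ne_bot

theorem isIsomorphic_idemAlg_of_dim_zero :
    IsIsomorphic (IdemAlg × ZeroAlg 0) IdemAlg := by
  refine ⟨NonUnitalAlgHom.fst ℂ _ _, fun x y h => Prod.ext h ?_, fun x => ⟨(x, 0), rfl⟩⟩
  ext i
  exact i.elim0

/-- Complete evolution algebras are of one of the four types. -/
theorem IsCompleteEvolutionAlgebra.classification [FiniteDimensional ℂ E] {n : ℕ} (hn : 1 ≤ n)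
    (hfin : finrank ℂ E = n) (hcomplete : IsCompleteEvolutionAlgebra E) :
    (n = 1 ∧ IsIsomorphic E IdemAlg) ∨
    (∃ (s : ℕ) (M : Matrix (Fin s) (Fin s) ℂ), 1 ≤ s ∧ s ≤ n ∧
      HasMaximalNilpotencyIndex (EvoAlg M) ∧
      IsIsomorphic E (EvoAlg M × ZeroAlg (n - s))) ∨
    (2 ≤ n ∧ IsIsomorphic E (IdemAlg × ZeroAlg (n - 1))) ∨
    (∃ (s : ℕ) (M : Matrix (Fin s) (Fin s) ℂ), 2 ≤ s ∧ s + 1 ≤ n ∧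
      HasMaximalNilpotencyIndex (EvoAlg M) ∧
      IsIsomorphic E (IdemAlg × EvoAlg M × ZeroAlg (n - s - 1))) := by
  have hE := hcomplete.isAbsorbing
  obtain ⟨v, hv⟩ := hcomplete.1.exists_basis
  obtain ⟨r, hr, hlt⟩ := exists_annSeries_stable E
  have hidem : finrank ℂ IdemAlg = 1 := EvoAlg.finrank_fin
  have hzero : ∀ d, finrank ℂ (ZeroAlg d) = d := fun d => EvoAlg.finrank_fin
  by_cases htop : annSeries E r = ⊤
  · right; left
    by_cases hr2 : 2 ≤ r
    · obtain ⟨s, M, d, hs, hM, g, hg, hgr⟩ := hv.exists_hom_annSeries hE hr2 hlt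
      have hiso := isIsomorphic_of_range_eq_top hg (hgr.trans htop)
      have hdim := hiso.finrank_eq
      rw [finrank_prod, EvoAlg.finrank_fin, hzero, hfin] at hdim
      obtain rfl : d = n - s := by omega
      exact ⟨s, M, by omega, by omega, hM, hiso⟩
    · have h1 : annSeries E 1 = ⊤ := top_le_iff.1 (htop ▸ annSeries_mono (by omega))
      -- The zero algebra counts as type 2 with s = 1: one line of it is the summand of maximal
      -- index.
      refine ⟨1, 0, le_rfl, hn, hasMaximalNilpotencyIndex_zeroAlg_one, ?_⟩
      refine isIsomorphic_of_mul_eq_zero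
        (fun x y => mul_eq_zero_of_mem_annSeries_one (h1 ▸ Submodule.mem_top) y)
        (fun x y => Prod.ext (EvoAlg.zero_mul_eq _ _ _) (EvoAlg.zero_mul_eq _ _ _)) ?_
      rw [finrank_prod, EvoAlg.finrank_fin, hzero, hfin]
      omega
  · obtain ⟨e, hee, he, heN, hcompl⟩ := hv.exists_idempotent_isCompl hE hr htop
    by_cases hr2 : 2 ≤ r
    · obtain ⟨s, M, d, hs, hM, g, hg, hgr⟩ := hv.exists_hom_annSeries hE hr2 hlt
      have hiso := isIsomorphic_idemAlg_prod hv.mul_comm hee he heN hcompl hg hgr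
      have hdim := hiso.finrank_eq
      rw [finrank_prod, finrank_prod, EvoAlg.finrank_fin, EvoAlg.finrank_fin, hzero, hfin] at hdim
      obtain rfl : d = n - s - 1 := by omega
      exact Or.inr (Or.inr (Or.inr ⟨s, M, hs, by omega, hM, hiso⟩))
    · obtain ⟨g, hg, hgr⟩ := exists_zeroAlg_hom (annSeries_mono (E := E) (by omega : r ≤ 1))
      have hiso := isIsomorphic_idemAlg_prod hv.mul_comm hee he heN hcompl hg hgr
      generalize finrank ℂ (annSeries E r) = d at hiso
      have hdim := hiso.finrank_eq
      rw [finrank_prod, hidem, hzero, hfin] at hdim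
      by_cases hn1 : n = 1
      · obtain rfl : d = 0 := by omega
        exact Or.inl ⟨hn1, hiso.trans isIsomorphic_idemAlg_of_dim_zero⟩
      · obtain rfl : d = n - 1 := by omega
        exact Or.inr (Or.inr (Or.inl ⟨by omega, hiso⟩))

end Classification

theorem mainTheorem4 (n : ℕ) (hn : 1 ≤ n) :
    -- every `n`-dimensional complete evolution algebra is of one of the four types
    (∀ (E : Type*) [NonUnitalNonAssocRing E] [Module ℂ E] [IsScalarTower ℂ E E]
        [SMulCommClass ℂ E E] [FiniteDimensional ℂ E],
      Module.finrank ℂ E = n → IsCompleteEvolutionAlgebra E →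
        (n = 1 ∧ IsIsomorphic E IdemAlg) ∨
        (∃ (s : ℕ) (M : Matrix (Fin s) (Fin s) ℂ), 1 ≤ s ∧ s ≤ n ∧
          HasMaximalNilpotencyIndex (EvoAlg M) ∧
          IsIsomorphic E (EvoAlg M × ZeroAlg (n - s))) ∨
        (2 ≤ n ∧ IsIsomorphic E (IdemAlg × ZeroAlg (n - 1))) ∨
        (∃ (s : ℕ) (M : Matrix (Fin s) (Fin s) ℂ), 2 ≤ s ∧ s + 1 ≤ n ∧
          HasMaximalNilpotencyIndex (EvoAlg M) ∧
          IsIsomorphic E (IdemAlg × EvoAlg M × ZeroAlg (n - s - 1)))) ∧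
    -- algebras of different types are not isomorphic: first type and second type
    (∀ (s : ℕ) (M : Matrix (Fin s) (Fin s) ℂ), 1 ≤ s → s ≤ n →
      HasMaximalNilpotencyIndex (EvoAlg M) →
      ¬ IsIsomorphic IdemAlg (EvoAlg M × ZeroAlg (n - s))) ∧
    -- first and third
    (2 ≤ n → ¬ IsIsomorphic IdemAlg (IdemAlg × ZeroAlg (n - 1))) ∧
    -- first and fourth
    (∀ (s : ℕ) (M : Matrix (Fin s) (Fin s) ℂ), 2 ≤ s → s + 1 ≤ n →
      HasMaximalNilpotencyIndex (EvoAlg M) →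
      ¬ IsIsomorphic IdemAlg (IdemAlg × EvoAlg M × ZeroAlg (n - s - 1))) ∧
    -- second and third
    (2 ≤ n → ∀ (s : ℕ) (M : Matrix (Fin s) (Fin s) ℂ), 1 ≤ s → s ≤ n →
      HasMaximalNilpotencyIndex (EvoAlg M) →
      ¬ IsIsomorphic (EvoAlg M × ZeroAlg (n - s)) (IdemAlg × ZeroAlg (n - 1))) ∧
    -- second and fourth
    (∀ (s : ℕ) (M : Matrix (Fin s) (Fin s) ℂ) (s' : ℕ) (M' : Matrix (Fin s') (Fin s') ℂ),
      1 ≤ s → s ≤ n → 2 ≤ s' → s' + 1 ≤ n →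
      HasMaximalNilpotencyIndex (EvoAlg M) → HasMaximalNilpotencyIndex (EvoAlg M') →
      ¬ IsIsomorphic (EvoAlg M × ZeroAlg (n - s))
          (IdemAlg × EvoAlg M' × ZeroAlg (n - s' - 1))) ∧
    -- third and fourth
    (∀ (s : ℕ) (M : Matrix (Fin s) (Fin s) ℂ), 2 ≤ s → s + 1 ≤ n →
      HasMaximalNilpotencyIndex (EvoAlg M) →
      ¬ IsIsomorphic (IdemAlg × ZeroAlg (n - 1))
          (IdemAlg × EvoAlg M × ZeroAlg (n - s - 1))) ∧
    -- isomorphic algebras of the second type have the same parameters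
    (∀ (s : ℕ) (M : Matrix (Fin s) (Fin s) ℂ) (s' : ℕ) (M' : Matrix (Fin s') (Fin s') ℂ),
      1 ≤ s → s ≤ n → 1 ≤ s' → s' ≤ n →
      HasMaximalNilpotencyIndex (EvoAlg M) → HasMaximalNilpotencyIndex (EvoAlg M') →
      IsIsomorphic (EvoAlg M × ZeroAlg (n - s)) (EvoAlg M' × ZeroAlg (n - s')) →
      s = s' ∧ IsIsomorphic (EvoAlg M) (EvoAlg M')) ∧
    -- isomorphic algebras of the fourth type have the same parameters
    (∀ (s : ℕ) (M : Matrix (Fin s) (Fin s) ℂ) (s' : ℕ) (M' : Matrix (Fin s') (Fin s') ℂ),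
      2 ≤ s → s + 1 ≤ n → 2 ≤ s' → s' + 1 ≤ n →
      HasMaximalNilpotencyIndex (EvoAlg M) → HasMaximalNilpotencyIndex (EvoAlg M') →
      IsIsomorphic (IdemAlg × EvoAlg M × ZeroAlg (n - s - 1))
        (IdemAlg × EvoAlg M' × ZeroAlg (n - s' - 1)) →
      s = s' ∧ IsIsomorphic (EvoAlg M) (EvoAlg M')) := by
  refine ⟨fun E _ _ _ _ _ hfin hE => hE.classification hn hfin, ?_, ?_, ?_, ?_, ?_, ?_, ?_, ?_⟩
  · exact fun s M _ _ hM =>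
      EvoAlg.not_isIsomorphic_of_idempotent hM.2.1 EvoAlg.idem_mul_idem EvoAlg.idem_ne_zero
  · intro hn2 h
    have hdim := h.finrank_eq
    rw [finrank_prod, EvoAlg.finrank_fin, EvoAlg.finrank_fin] at hdim
    omega
  · intro s M hs hsn _ h
    have hdim := h.finrank_eq
    rw [finrank_prod, finrank_prod, EvoAlg.finrank_fin, EvoAlg.finrank_fin] at hdim
    omega
  · intro _ s M _ _ hM h
    refine EvoAlg.not_isIsomorphic_of_idempotent hM.2.1 (e := (EvoAlg.idem, 0)) ?_ ?_ h.symm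
    · exact Prod.ext EvoAlg.idem_mul_idem (mul_zero _)
    · exact fun h0 => EvoAlg.idem_ne_zero (congrArg Prod.fst h0)
  · intro s M s' M' _ _ _ _ hM _ h
    refine EvoAlg.not_isIsomorphic_of_idempotent hM.2.1 (e := (EvoAlg.idem, 0)) ?_ ?_ h.symm
    · exact Prod.ext EvoAlg.idem_mul_idem (mul_zero _)
    · exact fun h0 => EvoAlg.idem_ne_zero (congrArg Prod.fst h0)
  · intro s M hs _ hM h
    -- After the idempotent is removed, the nilpotent summand would embed into a zero algebra,
    -- although for s ≥ 2 it has a nonzero product.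
    obtain ⟨x, y, hxy⟩ := EvoAlg.exists_mul_ne_zero hM hs
    obtain ⟨f, hf⟩ := EvoAlg.exists_injective_of_idem_prod hM.2.1 h.symm
    exact hxy (hf (by rw [map_mul, map_zero, EvoAlg.zero_mul_eq]))
  · intro s M s' M' hs _ hs' _ hM hM' h
    obtain ⟨f, hf⟩ := EvoAlg.exists_injective_of_prod h
    obtain ⟨f', hf'⟩ := EvoAlg.exists_injective_of_prod h.symm
    exact EvoAlg.eq_and_isIsomorphic hM hM' hs hs' f hf f' hf'
  · intro s M s' M' hs _ hs' _ hM hM' h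
    obtain ⟨f, hf⟩ := EvoAlg.exists_injective_of_idem_prod hM.2.1 h
    obtain ⟨f', hf'⟩ := EvoAlg.exists_injective_of_idem_prod hM'.2.1 h.symm
    exact EvoAlg.eq_and_isIsomorphic hM hM' (by omega) (by omega) f hf f' hf'
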